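/- Let $S_1,\dots,S_m$ be a stream of subsets of a finite universe $\mathcal U$ with $|\mathcal U|=n$, let $1\le k\le m$, $c>0$ and $0<\varepsilon<1-1/e$. Write $\|S\|_\infty=\max_i|S_i|$, $\mathrm{OPT}=\max_{|J|=k}\bigl|\bigcup_{i\in J}S_i\bigr|$, $\delta(\varepsilon)=\varepsilon(3-1/e-\varepsilon)$ and $\lambda=c\,\varepsilon^{-2}k\log m$ (natural logarithm). The sketch-free algorithm $\mathsf{MACH}'_\gamma$ is the following. Let $V=\{\,2^{g-1}\|S\|_\infty\le\min(n,k\|S\|_\infty): g=0,1,2,\dots\}$ be the set of guesses, with elements $v_0<v_1<\dots<v_{|V|-1}$. Each guess $v_g$ has a random function $h_g:\mathcal U\to\{0,1\}$ for which $\Pr[h_g(x)=1]=\min(1,\lambda/v_g)$ for every $x\in\mathcal U$ and, for any at most $\gamma$ distinct elements $x$ of $\mathcal U$, the values $h_g(x)$ are independent (nothing is assumed about the joint law of the $h_g$ for different $g$). For each guess start with $I_g=\emptyset$, $C'_g=\emptyset$, the guess active, and $r=2(1+\varepsilon)\lambda/k$. Make $1+\lceil\log_{1+\varepsilon}(4e)\rceil$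 passes over the stream, dividing $r$ by $1+\varepsilon$ after each pass. When $S_i$ arrives, do the following for each guess: 1. put $R_i=\{x\in S_i:h_g(x)=1\}\setminus C'_g$; 2. if $|I_g|<k$ and $|C'_g|+|R_i|>2(1+\varepsilon)\lambda$, make the guess inactive (permanently); 3. if the guess is active, $|I_g|<k$ and $|R_i|\ge r$, replace $I_g$ by $I_g\cup\{i\}$ and $C'_g$ by $C'_g\cup R_i$. After the last pass the procedure $\mathtt{FindGuess}$ goes through $s=|V|-1,|V|-2,\dots,0$ and stops at the first $s$ for which guess $s$ is active and $|C'_s|\ge(1-\varepsilon)(1-1/e-\varepsilon)\lambda$; the algorithm returns $I_s$ (it fails if there is no such $s$). Assume that $\lambda\le v$ for every guess $v\in V$ with $\mathrm{OPT}/2\le v\le\mathrm{OPT}$, so that the sampling probability at such a guess is $\lambda/v$. Then, for every integer $\gamma\ge\lfloor\tfrac c3k\log m\rfloor$, with probability at least $$1-\frac{2e}{k!\;m^{(c/6-1)k}}$$ the algorithm $\mathsf{MACH}'_\gamma$ returns a $(1-1/e-\delta(\varepsilon))$-approximation to Maximum-$k$-Coverage, that is, a set $I$ of at most $k$ indices with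 $\bigl|\bigcup_{i\in I}S_i\bigr|\ge(1-1/e-\delta(\varepsilon))\,\mathrm{OPT}$. -/

import Mathlib

open MeasureTheory ProbabilityTheory

namespace MaxCover

/-! ### The Maximum-`k`-Coverage problem

A stream is a sequence `S 0, S 1, …, S (m - 1)` of subsets of a finite universe `U`. -/

section Problem

variable {U : Type*} [DecidableEq U] {m : ℕ}

/-- The coverage `⋃ i ∈ I, S i` of the sets whose indices lie in `I`. -/
def coverage (S : Fin m → Finset U) (I : Finset (Fin m)) : Finset U := I.biUnion S

/-- `OPT`: the largest size of the union of `k` sets of the family (used for `k ≤ m`). -/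
def opt (S : Fin m → Finset U) (k : ℕ) : ℕ :=
  (Finset.powersetCard k Finset.univ).sup fun J => (coverage S J).card

end Problem

/-- The maximum size of a set of the stream, written `‖S‖_∞`. -/
def maxSetSize {U : Type*} {m : ℕ} (S : Fin m → Finset U) : ℕ :=
  Finset.univ.sup fun i => (S i).card

/-- `δ(ε) = ε (3 - 1/e - ε)`. -/
noncomputable def delta (ε : ℝ) : ℝ := ε * (3 - 1 / Real.exp 1 - ε)

/-- The space budget `λ = c ε⁻² k log m`. -/
noncomputable def spaceBudget (c ε : ℝ) (k m : ℕ) : ℝ := c / ε ^ 2 * k * Real.log m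

/-! ### The guesses for `OPT` -/

/-- The guess with index `g`, namely `2 ^ (g - 1) ‖S‖_∞`. -/
noncomputable def guess {U : Type*} {m : ℕ} (S : Fin m → Finset U) (g : ℕ) : ℝ :=
  2 ^ g * (maxSetSize S : ℝ) / 2

/-- The set `V` of the guesses: all `2 ^ (g - 1) ‖S‖_∞ ≤ min (n, k ‖S‖_∞)` with `g ∈ ℕ`, where
`n` is the size of the universe. -/
def guessSet {U : Type*} [Fintype U] {m : ℕ} (S : Fin m → Finset U) (k : ℕ) : Set ℝ :=
  {v | ∃ g : ℕ, v = guess S g ∧ v ≤ min (Fintype.card U : ℝ) (k * (maxSetSize S : ℝ))}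

/-- The number `|V|` of guesses. The guesses increase with the index, so that `V` consists of
`guess S 0, …, guess S (|V| - 1)`. -/
noncomputable def numGuesses {U : Type*} [Fintype U] {m : ℕ} (S : Fin m → Finset U) (k : ℕ) : ℕ :=
  (guessSet S k).ncard

/-! ### Random subsampling -/

/-- A random function `h : U → {0, 1}` is a `γ`-independent subsampling function with sampling
probability `p`: every element is sampled with probability `p`, and for any at most `γ` distinct
elements of `U` the values of `h` at them are independent. -/
structure IsSampling {Ω : Type*} [MeasurableSpace Ω] (P : Measure Ω) {U : Type*}
    (γ : ℕ) (p : ℝ) (h : Ω → U → Bool) : Prop where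
  measurable : ∀ x, Measurable fun ω => h ω x
  prob : ∀ x, P.real {ω | h ω x = true} = p
  indep : ∀ A : Finset U, A.card ≤ γ → iIndepFun (fun (x : A) ω => h ω x) P

/-! ### The thresholding procedure for one guess

The algorithm keeps one copy of the variables below for each guess. The copies do not interact
before a guess is selected, so the interleaved loop over the guesses is described by one run for
each guess. -/

section Algorithm

variable {U : Type*} [DecidableEq U] {m : ℕ}

/-- The variables kept for one guess: the indices `I` selected so far, the subsampled coverage `C'`,
and the flag that tells whether the guess is still active. -/
structure State (U : Type*) (m : ℕ) where
  sol : Finset (Fin m)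
  cov : Finset U
  active : Bool

/-- Initially nothing is selected and the guess is active. -/
def State.init (U : Type*) (m : ℕ) : State U m := ⟨∅, ∅, true⟩

/-- The subsampled set `S' = {x ∈ S | h x = 1}`. -/
def subsample (h : U → Bool) (S : Finset U) : Finset U := S.filter fun x => h x = true

/-- The contribution `R_i = S_i' \ C'` of the set with index `i`. -/
def contribution (S : Fin m → Finset U) (h : U → Bool) (st : State U m) (i : Fin m) : Finset U :=
  subsample h (S i) \ st.cov

open Classical in
/-- The bad guess test: as long as fewer than `k` sets are selected, the guess is deactivated when
`|C'| + |R_i| > 2 (1 + ε) lam`. -/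
noncomputable def checkBad (S : Fin m → Finset U) (k : ℕ) (ε lam : ℝ) (h : U → Bool)
    (st : State U m) (i : Fin m) : State U m :=
  if st.sol.card < k ∧
      2 * (1 + ε) * lam < (st.cov.card : ℝ) + ((contribution S h st i).card : ℝ) then
    { st with active := false }
  else st

open Classical in
/-- The selection rule with threshold `r`. -/
noncomputable def select (S : Fin m → Finset U) (k : ℕ) (r : ℝ) (h : U → Bool)
    (st : State U m) (i : Fin m) : State U m :=
  if st.active = true ∧ st.sol.card < k ∧ r ≤ ((contribution S h st i).card : ℝ) then
    { st with sol := insert i st.sol, cov := st.cov ∪ contribution S h st i }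
  else st

/-- Processing the set with index `i` when it arrives in the stream. -/
noncomputable def processSet (S : Fin m → Finset U) (k : ℕ) (ε lam r : ℝ) (h : U → Bool)
    (st : State U m) (i : Fin m) : State U m :=
  select S k r h (checkBad S k ε lam h st i) i

/-- One pass over the stream with threshold `r`. -/
noncomputable def onePass (S : Fin m → Finset U) (k : ℕ) (ε lam r : ℝ) (h : U → Bool)
    (st : State U m) : State U m :=
  (List.finRange m).foldl (processSet S k ε lam r h) st

/-- The threshold in the pass with index `t = 0, 1, …`: it starts at `2 (1 + ε) lam / k` and is
divided by `1 + ε` after each pass. -/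
noncomputable def threshold (k : ℕ) (ε lam : ℝ) (t : ℕ) : ℝ :=
  2 * (1 + ε) * lam / k / (1 + ε) ^ t

/-- The number of passes, `1 + ⌈log_{1 + ε} (4 e)⌉`. -/
noncomputable def numPasses (ε : ℝ) : ℕ := 1 + ⌈Real.logb (1 + ε) (4 * Real.exp 1)⌉₊

/-- The state at the end of all passes, for a guess with subsampling function `h`. -/
noncomputable def finalState (S : Fin m → Finset U) (k : ℕ) (ε lam : ℝ) (h : U → Bool) :
    State U m :=
  (List.range (numPasses ε)).foldl
    (fun st t => onePass S k ε lam (threshold k ε lam t) h st) (State.init U m)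

/-- The condition under which `FindGuess` stops at a guess with final state `st`. -/
def Acceptable (ε lam : ℝ) (st : State U m) : Prop :=
  st.active = true ∧ (1 - ε) * (1 - 1 / Real.exp 1 - ε) * lam ≤ (st.cov.card : ℝ)

open Classical in
/-- The procedure `FindGuess`: go through the guesses with indices `N - 1, N - 2, …, 0` and stop at
the first acceptable one; the result is `none` if there is none. -/
noncomputable def findGuess (ε lam : ℝ) (final : ℕ → State U m) : ℕ → Option ℕ
  | 0 => none
  | s + 1 => if Acceptable ε lam (final s) then some s else findGuess ε lam final s

/-- The sketch-free algorithm `MACH'`: run the thresholding procedure for each guess, where the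
guess with index `g` uses the subsampling function `h g`, and return the solution of the guess that
is selected by `FindGuess`. -/
noncomputable def machSketchFree [Fintype U] (S : Fin m → Finset U) (k : ℕ) (ε lam : ℝ)
    (h : ℕ → U → Bool) : Option (Finset (Fin m)) :=
  (findGuess ε lam (fun g => finalState S k ε lam (h g)) (numGuesses S k)).map
    fun s => (finalState S k ε lam (h s)).sol

end Algorithm

end MaxCover

namespace MaxCover

/-! Put L = (c/6) k log m, so that ε²λ = 6L. The claim follows from a union bound over the index
sets J with |J| ≤ k. There are at most 2m^k/k! of them (`factorial_mul_card_le`), and each one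
causes a failure with probability at most e^{1-L}; the product is the stated bound. Only marginal
laws of the single `h g` enter, so their joint law is irrelevant.

Let v be the largest guess not exceeding OPT. If every sampled coverage is within ελ of its mean at
v, the bad-guess test never fires, greedy thresholding is a (1-1/e-ε)-approximation on the sample
(`finalState_approx`), and scaling back by v/λ gives an acceptable and good solution
(`finalState_right_guess`). Since `findGuess` goes downwards, it then stops at v or at a larger
guess. A larger guess does harm only if some J with coverage below b·OPT, where b = 1-1/e-δ(ε),
shows at least (b+ε)λ sampled elements, although its mean there is at most bλ, halved with each
further guess (`machSketchFree_correct`).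

Limited independence suffices because moments of order at most γ are binomial
(`IsSampling.integral_sub_pow`). The central moment of order 2⌊L⌋ handles v and the next guess
(`IsSampling.deviation_le`). For the remaining guesses the binomial moment of order ⌊2L⌋ gives a
bound that decays geometrically, so their number does not matter (`IsSampling.far_tail_le`). The
three contributions are 0.504, 0.111 and 0.364 times e^{1-L}. -/

/-! ### Moments of the binomial distribution -/

/-- The expectation of `f` under the binomial distribution with parameters `N` and `p`. -/
noncomputable def binomialExp (N : ℕ) (p : ℝ) (f : ℕ → ℝ) : ℝ :=
  ∑ j ∈ Finset.range (N + 1), (N.choose j : ℝ) * p ^ j * (1 - p) ^ (N - j) * f j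

lemma binomialExp_add (N : ℕ) (p : ℝ) (f g : ℕ → ℝ) :
    binomialExp N p (fun j => f j + g j) = binomialExp N p f + binomialExp N p g := by
  simp only [binomialExp, mul_add, Finset.sum_add_distrib]

lemma binomialExp_const_mul (N : ℕ) (p a : ℝ) (f : ℕ → ℝ) :
    binomialExp N p (fun j => a * f j) = a * binomialExp N p f := by
  simp only [binomialExp, Finset.mul_sum]
  exact Finset.sum_congr rfl fun _ _ => by ring

lemma binomialExp_sum {ι : Type*} (s : Finset ι) (N : ℕ) (p : ℝ) (f : ι → ℕ → ℝ) :
    binomialExp N p (fun j => ∑ i ∈ s, f i j) = ∑ i ∈ s, binomialExp N p (f i) := by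
  simp only [binomialExp, Finset.mul_sum]
  exact Finset.sum_comm

lemma binomialExp_mono {N : ℕ} {p : ℝ} (hp0 : 0 ≤ p) (hp1 : p ≤ 1) {f g : ℕ → ℝ}
    (hfg : ∀ j, f j ≤ g j) : binomialExp N p f ≤ binomialExp N p g := by
  unfold binomialExp
  have : 0 ≤ 1 - p := by linarith
  gcongr with j _
  exact hfg j

/-- From C(N,j) C(j,r) = C(N,r) C(N-r,j-r), after which the binomial theorem sums the remaining
weights to 1. -/
lemma binomialExp_choose (N r : ℕ) (p : ℝ) :
    binomialExp N p (fun j => (j.choose r : ℝ)) = N.choose r * p ^ r := by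
  unfold binomialExp
  rcases lt_or_ge N r with h | h
  · rw [Nat.choose_eq_zero_of_lt h, Finset.sum_eq_zero]
    · simp
    · intro j hj
      have : j < r := by have := Finset.mem_range.1 hj; omega
      simp [Nat.choose_eq_zero_of_lt this]
  · obtain ⟨d, rfl⟩ := Nat.exists_eq_add_of_le h
    rw [add_assoc, Finset.sum_range_add, Finset.sum_eq_zero, zero_add]
    · have h1 := add_pow p (1 - p) d
      rw [add_sub_cancel, one_pow] at h1
      calc _ = ∑ x ∈ Finset.range (d + 1),
            ((r + d).choose r * p ^ r) * (p ^ x * (1 - p) ^ (d - x) * d.choose x) := by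
              refine Finset.sum_congr rfl fun x hx => ?_
              have hx' : x ≤ d := Nat.lt_succ_iff.1 (Finset.mem_range.1 hx)
              have h2 := Nat.choose_mul (n := r + d) (k := r + x) (s := r)
              rw [Nat.add_sub_cancel_left, Nat.add_sub_cancel_left] at h2
              have h3 : ((r + d).choose (r + x) : ℝ) * (r + x).choose r
                  = (r + d).choose r * d.choose x := by exact_mod_cast h2 (by omega)
              rw [Nat.add_sub_add_left, pow_add]
              dsimp only
              linear_combination (p ^ r * p ^ x * (1 - p) ^ (d - x)) * h3
        _ = _ := by rw [← Finset.mul_sum, ← h1, mul_one]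
    · intro j hj
      simp [Nat.choose_eq_zero_of_lt (Finset.mem_range.1 hj)]

lemma binomialExp_exp (N : ℕ) (p s : ℝ) :
    binomialExp N p (fun j => Real.exp (s * j)) = (p * Real.exp s + (1 - p)) ^ N := by
  unfold binomialExp
  rw [add_pow]
  refine Finset.sum_congr rfl fun j _ => ?_
  rw [mul_pow, ← Real.exp_nat_mul, mul_comm (j : ℝ) s]
  ring

/-- The cubic Taylor remainder is at most (2/9)|s|³, and 1/2 + (2/9)·0.26 < 0.56. The range 0.26
covers the parameter √(l/λ) chosen in `IsSampling.deviation_le`. -/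
lemma exp_le_quadratic {s : ℝ} (hs : |s| ≤ 0.26) : Real.exp s ≤ 1 + s + 0.56 * s ^ 2 := by
  have h := Real.exp_bound (x := s) (by linarith) (n := 3) (by norm_num)
  simp only [Finset.sum_range_succ, Finset.sum_range_zero] at h
  norm_num [Nat.factorial] at h
  have h1 := (abs_le.1 h).2
  have h2 : |s| ^ 3 = |s| * s ^ 2 := by rw [pow_succ', sq_abs]
  rw [h2] at h1
  nlinarith [mul_le_mul_of_nonneg_right hs (sq_nonneg s), sq_nonneg s]

lemma binomialExp_exp_centered_le {N : ℕ} {p s : ℝ} (hp0 : 0 ≤ p) (hp1 : p ≤ 1)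
    (hs : |s| ≤ 0.26) :
    binomialExp N p (fun j => Real.exp (s * (j - N * p))) ≤
      Real.exp (0.56 * (N * p) * s ^ 2) := by
  have h1 : (fun j : ℕ => Real.exp (s * (j - N * p)))
      = fun j : ℕ => Real.exp (-(s * (N * p))) * Real.exp (s * j) := by
    funext j
    rw [← Real.exp_add]
    ring_nf
  have h2 : p * Real.exp s + (1 - p) ≤ Real.exp (p * (s + 0.56 * s ^ 2)) := by
    have h3 := Real.add_one_le_exp (p * (s + 0.56 * s ^ 2))
    nlinarith [mul_le_mul_of_nonneg_left (exp_le_quadratic hs) hp0]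
  have h4 : 0 ≤ p * Real.exp s + (1 - p) := by
    have := mul_nonneg hp0 (Real.exp_pos s).le
    linarith
  rw [h1, binomialExp_const_mul, binomialExp_exp]
  calc _ ≤ Real.exp (-(s * (N * p))) * (Real.exp (p * (s + 0.56 * s ^ 2))) ^ N := by gcongr
    _ = _ := by
      rw [← Real.exp_nat_mul, ← Real.exp_add]
      ring_nf

/-- Apply y ≤ e^{y-1} to y = s|x|/(2l) and raise to the power 2l. This bounds an even moment by the
two exponential moments at ±s. -/
lemma pow_two_mul_le_exp {l : ℕ} (hl : 0 < l) {s : ℝ} (hs : 0 < s) (x : ℝ) :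
    x ^ (2 * l) ≤ (2 * l / (Real.exp 1 * s)) ^ (2 * l) *
      (Real.exp (s * x) + Real.exp (-s * x)) := by
  have hl' : (0 : ℝ) < l := by exact_mod_cast hl
  have h1 : s * |x| / (2 * l) ≤ Real.exp (s * |x| / (2 * l) - 1) := by
    have := Real.add_one_le_exp (s * |x| / (2 * l) - 1)
    linarith
  have h2 : |x| ≤ 2 * l / (Real.exp 1 * s) * Real.exp (s * |x| / (2 * l)) := by
    rw [Real.exp_sub] at h1
    calc |x| = (2 * l / s) * (s * |x| / (2 * l)) := by field_simp
      _ ≤ (2 * l / s) * (Real.exp (s * |x| / (2 * l)) / Real.exp 1) := by gcongr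
      _ = _ := by field_simp
  have h3 : Real.exp (s * |x| / (2 * l)) ^ (2 * l) = Real.exp (s * |x|) := by
    rw [← Real.exp_nat_mul]
    congr 1
    push_cast
    field_simp
  calc x ^ (2 * l) = |x| ^ (2 * l) := by rw [pow_mul, pow_mul, sq_abs]
    _ ≤ (2 * l / (Real.exp 1 * s) * Real.exp (s * |x| / (2 * l))) ^ (2 * l) := by gcongr
    _ = (2 * l / (Real.exp 1 * s)) ^ (2 * l) * Real.exp (s * |x|) := by rw [mul_pow, h3]
    _ ≤ _ := by
      gcongr
      rcases abs_cases x with ⟨h, _⟩ | ⟨h, _⟩ <;> rw [h]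
      · linarith [Real.exp_pos (-s * x)]
      · rw [mul_neg, ← neg_mul]
        linarith [Real.exp_pos (s * x)]

lemma binomialExp_central_moment_le {N l : ℕ} (hl : 0 < l) {p s : ℝ} (hp0 : 0 ≤ p) (hp1 : p ≤ 1)
    (hs0 : 0 < s) (hs : s ≤ 0.26) :
    binomialExp N p (fun j => ((j : ℝ) - N * p) ^ (2 * l)) ≤
      (2 * l / (Real.exp 1 * s)) ^ (2 * l) * (2 * Real.exp (0.56 * (N * p) * s ^ 2)) := by
  refine (binomialExp_mono hp0 hp1 fun j => pow_two_mul_le_exp hl hs0 _).trans ?_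
  rw [binomialExp_const_mul, binomialExp_add]
  have h1 := binomialExp_exp_centered_le (N := N) hp0 hp1 (s := s) (by rwa [abs_of_pos hs0])
  have h2 := binomialExp_exp_centered_le (N := N) hp0 hp1 (s := -s)
    (by rwa [abs_neg, abs_of_pos hs0])
  rw [neg_sq] at h2
  gcongr
  linarith

/-- Powers of `n - a` are linear combinations of binomial coefficients. -/
lemma exists_pow_eq_sum_choose (a : ℝ) (r : ℕ) :
    ∃ b : ℕ → ℝ, ∀ n : ℕ, ((n : ℝ) - a) ^ r = ∑ i ∈ Finset.range (r + 1), b i * n.choose i := by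
  induction r with
  | zero => exact ⟨fun _ => 1, fun n => by simp⟩
  | succ r ih =>
    obtain ⟨b, hb⟩ := ih
    refine ⟨fun i => (if i = 0 then 0 else b (i - 1) * i) +
      (if i = r + 1 then 0 else b i * (i - a)), fun n => ?_⟩
    -- This recursion dictates the new coefficients: multiplying by n - a sends C(n,i) to C(n,i+1)
    -- and C(n,i) only.
    have key : ∀ i : ℕ, ((n : ℝ) - a) * n.choose i
        = (i + 1) * n.choose (i + 1) + (i - a) * n.choose i := by
      intro i
      have h := Nat.choose_succ_right_eq n i
      rcases le_or_gt i n with hi | hi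
      · have h' : (n.choose (i + 1) : ℝ) * (i + 1) = n.choose i * (n - i) := by
          rw [← Nat.cast_sub hi]
          exact_mod_cast h
        linear_combination -h'
      · rw [Nat.choose_eq_zero_of_lt hi, Nat.choose_eq_zero_of_lt (by omega : n < i + 1)]
        simp
    simp only [add_mul, Finset.sum_add_distrib]
    rw [Finset.sum_range_succ' (fun i => (if i = 0 then 0 else b (i - 1) * i) * (n.choose i : ℝ)),
      Finset.sum_range_succ (fun i => (if i = r + 1 then 0 else b i * (i - a)) * (n.choose i : ℝ)),
      pow_succ, hb, Finset.sum_mul]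
    simp only [if_true, zero_mul, add_zero, ← Finset.sum_add_distrib]
    refine Finset.sum_congr rfl fun i hi => ?_
    have hi' : i ≠ r + 1 := (Finset.mem_range.1 hi).ne
    rw [if_neg (Nat.succ_ne_zero i), if_neg hi']
    push_cast [Nat.add_sub_cancel]
    linear_combination b i * key i

/-! ### Moments and tails of a sample with limited independence -/

section Moments

variable {Ω : Type*} [MeasurableSpace Ω] {P : Measure Ω} [IsProbabilityMeasure P]
  {U : Type*} [Fintype U] {γ : ℕ} {p : ℝ} {h : Ω → U → Bool}

lemma IsSampling.integrable (hs : IsSampling P γ p h) (g : (U → Bool) → ℝ) :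
    Integrable (fun ω => g (h ω)) P := by
  classical
  have hm : Measurable h := measurable_pi_iff.2 hs.measurable
  refine Integrable.of_bound (C := ∑ y, |g y|)
    ((Measurable.of_discrete (f := g)).comp hm).aestronglyMeasurable (ae_of_all _ fun ω => ?_)
  exact Finset.single_le_sum (f := fun y => |g y|) (fun _ _ => abs_nonneg _)
    (Finset.mem_univ (h ω))

lemma IsSampling.measureReal_forall {Ω : Type*} [MeasurableSpace Ω] {P : Measure Ω}
    {U : Type*} {γ : ℕ} {p : ℝ} {h : Ω → U → Bool} (hs : IsSampling P γ p h) {T : Finset U}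
    (hT : T.card ≤ γ) :
    P.real {ω | ∀ x ∈ T, h ω x = true} = p ^ T.card := by
  have h1 := (hs.indep T hT).measure_inter_preimage_eq_mul Finset.univ
    (sets := fun _ => {true}) (fun _ _ => MeasurableSet.singleton _)
  have h2 : (⋂ i ∈ (Finset.univ : Finset T), (fun ω => h ω i) ⁻¹' {true})
      = {ω | ∀ x ∈ T, h ω x = true} := by
    ext ω
    simp
  rw [h2] at h1
  have h3 : ∀ x, (P ((fun ω => h ω x) ⁻¹' {true})).toReal = p := hs.prob
  rw [measureReal_def, h1, ENNReal.toReal_prod, Finset.prod_congr rfl fun (x : T) _ => h3 x]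
  simp

/-- C(X,r) counts the r-subsets of A that are entirely sampled. Each is sampled with probability
p^r, by independence of only r ≤ γ values. -/
lemma IsSampling.integral_choose (hs : IsSampling P γ p h) (A : Finset U) {r : ℕ} (hr : r ≤ γ) :
    ∫ ω, ((subsample (h ω) A).card.choose r : ℝ) ∂P = A.card.choose r * p ^ r := by
  classical
  have h1 : ∀ ω, ((subsample (h ω) A).card.choose r : ℝ)
      = ∑ T ∈ A.powersetCard r, {ω | ∀ x ∈ T, h ω x = true}.indicator (1 : Ω → ℝ) ω := by
    intro ω
    rw [← Finset.card_powersetCard]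
    simp only [Set.indicator_apply, Set.mem_ofPred_eq, Pi.one_apply, Finset.sum_boole]
    congr 2
    ext T
    simp only [Finset.mem_powersetCard, Finset.mem_filter, subsample, Finset.subset_iff]
    grind
  have hmeas : ∀ T : Finset U, MeasurableSet {ω | ∀ x ∈ T, h ω x = true} := by
    intro T
    have hm : Measurable h := measurable_pi_iff.2 hs.measurable
    exact hm (MeasurableSet.of_discrete (s := {y : U → Bool | ∀ x ∈ T, y x = true}))
  simp only [h1]
  rw [integral_finsetSum]
  · rw [Finset.sum_congr rfl (g := fun _ => p ^ r)]
    · simp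
    · intro T hT
      have hc := (Finset.mem_powersetCard.1 hT).2
      rw [integral_indicator_one (hmeas T), hs.measureReal_forall (hc.trans_le hr), hc]
  · intro T _
    exact (integrable_const (1 : ℝ)).indicator (hmeas T)

/-- Moments of order at most `γ` agree with those of the binomial distribution. -/
lemma IsSampling.integral_sub_pow (hs : IsSampling P γ p h) (A : Finset U) (a : ℝ) {r : ℕ}
    (hr : r ≤ γ) :
    ∫ ω, (((subsample (h ω) A).card : ℝ) - a) ^ r ∂P =
      binomialExp A.card p fun j => ((j : ℝ) - a) ^ r := by
  obtain ⟨b, hb⟩ := exists_pow_eq_sum_choose a r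
  simp only [hb]
  rw [integral_finsetSum, binomialExp_sum]
  · refine Finset.sum_congr rfl fun i hi => ?_
    rw [integral_const_mul, binomialExp_const_mul, binomialExp_choose,
      hs.integral_choose A ((Nat.lt_succ_iff.1 (Finset.mem_range.1 hi)).trans hr)]
  · intro i _
    exact hs.integrable fun y => b i * ((subsample y A).card.choose i : ℝ)

/-- Markov's inequality for the central moment of order 2l ≤ γ, with s left free for optimization.
-/
lemma IsSampling.central_tail_le (hs : IsSampling P γ p h) (hp0 : 0 ≤ p) (hp1 : p ≤ 1)
    (A : Finset U) {l : ℕ} (hl : 0 < l) (hlγ : 2 * l ≤ γ) {s d : ℝ} (hs0 : 0 < s) (hs1 : s ≤ 0.26)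
    (hd : 0 < d) :
    P.real {ω | d ≤ |((subsample (h ω) A).card : ℝ) - A.card * p|} ≤
      (2 * l / (Real.exp 1 * s * d)) ^ (2 * l) *
        (2 * Real.exp (0.56 * (A.card * p) * s ^ 2)) := by
  have h1 := mul_meas_ge_le_integral_of_nonneg (μ := P)
    (f := fun ω => (((subsample (h ω) A).card : ℝ) - A.card * p) ^ (2 * l))
    (ae_of_all _ fun ω => (even_two_mul l).pow_nonneg _)
    (hs.integrable fun y => (((subsample y A).card : ℝ) - A.card * p) ^ (2 * l)) (d ^ (2 * l))
  rw [hs.integral_sub_pow A _ hlγ] at h1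
  have h2 := h1.trans (binomialExp_central_moment_le hl hp0 hp1 hs0 hs1)
  have h3 : P.real {ω | d ≤ |((subsample (h ω) A).card : ℝ) - A.card * p|} ≤
      P.real {ω | d ^ (2 * l) ≤ (((subsample (h ω) A).card : ℝ) - A.card * p) ^ (2 * l)} := by
    refine measureReal_mono fun ω hω => ?_
    simp only [Set.mem_ofPred_eq] at hω ⊢
    rw [← (even_two_mul l).pow_abs (((subsample (h ω) A).card : ℝ) - A.card * p)]
    gcongr
  refine h3.trans ?_
  rw [mul_comm (d ^ (2 * l)), ← le_div_iff₀ (by positivity)] at h2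
  refine h2.trans (le_of_eq ?_)
  rw [← div_div (2 * (l : ℝ)) (Real.exp 1 * s) d, div_pow _ d]
  ring

/-- Markov's inequality for C(X,q), using (X-q)^q/q! ≤ C(X,q) when X ≥ q, and C(|A|,q) ≤ |A|^q/q!.
Unlike the central bound, this one tends to 0 with the mean when q ≥ 1. -/
lemma IsSampling.upper_tail_le (hs : IsSampling P γ p h) (hp0 : 0 ≤ p)
    (A : Finset U) {q : ℕ} (hq : q ≤ γ) {t : ℝ} (ht : (q : ℝ) < t) :
    P.real {ω | t ≤ ((subsample (h ω) A).card : ℝ)} ≤ (A.card * p / (t - q)) ^ q := by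
  have h1 := mul_meas_ge_le_integral_of_nonneg (μ := P)
    (f := fun ω => ((subsample (h ω) A).card.choose q : ℝ))
    (ae_of_all _ fun ω => Nat.cast_nonneg _)
    (hs.integrable fun y => ((subsample y A).card.choose q : ℝ)) ((t - q) ^ q / q.factorial)
  rw [hs.integral_choose A hq] at h1
  have hf : (0 : ℝ) < q.factorial := by exact_mod_cast q.factorial_pos
  have ht' : 0 < t - q := by linarith
  have h3 : P.real {ω | t ≤ ((subsample (h ω) A).card : ℝ)} ≤
      P.real {ω | (t - q) ^ q / q.factorial ≤ ((subsample (h ω) A).card.choose q : ℝ)} := by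
    refine measureReal_mono fun ω hω => ?_
    simp only [Set.mem_ofPred_eq] at hω ⊢
    set n := (subsample (h ω) A).card
    have hqn : q ≤ n := by exact_mod_cast (ht.trans_le hω).le
    have h4 : ((n + 1 - q : ℕ) : ℝ) ^ q ≤ q.factorial * n.choose q := by
      have := Nat.pow_sub_le_descFactorial n q
      rw [Nat.descFactorial_eq_factorial_mul_choose] at this
      exact_mod_cast this
    rw [div_le_iff₀ hf, mul_comm]
    refine le_trans ?_ h4
    gcongr
    rw [Nat.cast_sub (by omega)]
    push_cast
    linarith
  have h5 := Nat.choose_le_pow_div (α := ℝ) q A.card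
  refine h3.trans ?_
  rw [div_pow, le_div_iff₀ (by positivity), mul_pow]
  have h6 := h1.trans (mul_le_mul_of_nonneg_right h5 (pow_nonneg hp0 q))
  rw [div_mul_eq_mul_div, div_mul_eq_mul_div, div_le_div_iff_of_pos_right hf] at h6
  linarith

end Moments

/-! ### The thresholding procedure on a sampled instance -/

/-- The relation also sees the list processed so far, so it can speak of the sets that have already
arrived in the current pass. -/
lemma foldl_invariant {α β : Type*} {f : β → α → β} {R : List α → β → Prop} {b : β}
    (h0 : R [] b) (hstep : ∀ l a b, R l b → R (l ++ [a]) (f b a)) (l : List α) :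
    R l (l.foldl f b) := by
  induction l using List.reverseRecOn with
  | nil => exact h0
  | append_singleton l a ih =>
    rw [List.foldl_append]
    exact hstep l a _ ih

section Greedy

variable {U : Type*} [DecidableEq U] {m : ℕ}

lemma coverage_mono (S : Fin m → Finset U) {I J : Finset (Fin m)} (h : I ⊆ J) :
    coverage S I ⊆ coverage S J := Finset.biUnion_subset_biUnion_of_subset_left S h

lemma subset_coverage (S : Fin m → Finset U) {I : Finset (Fin m)} {i : Fin m} (hi : i ∈ I) :
    S i ⊆ coverage S I := Finset.subset_biUnion_of_mem S hi

lemma subsample_mono {U : Type*} (h : U → Bool) {A B : Finset U} (hAB : A ⊆ B) :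
    subsample h A ⊆ subsample h B := Finset.filter_subset_filter _ hAB

lemma subsample_coverage_insert (S : Fin m → Finset U) (h : U → Bool) (I : Finset (Fin m))
    (i : Fin m) :
    subsample h (coverage S (insert i I)) =
      subsample h (coverage S I) ∪ (subsample h (S i) \ subsample h (coverage S I)) := by
  rw [Finset.union_sdiff_self_eq_union, coverage, coverage, Finset.biUnion_insert, subsample,
    subsample, subsample, Finset.filter_union, Finset.union_comm]

/-- The sampled coverage recorded in the state is that of at most `k` selected sets. -/
def State.Consistent (S : Fin m → Finset U) (k : ℕ) (h : U → Bool) (st : State U m) : Prop :=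
  st.cov = subsample h (coverage S st.sol) ∧ st.sol.card ≤ k

variable {S : Fin m → Finset U} {k : ℕ} {ε lam r : ℝ} {h : U → Bool} {st : State U m}

lemma State.Consistent.insert_cov (hst : st.Consistent S k h) (i : Fin m) :
    st.cov ∪ contribution S h st i = subsample h (coverage S (insert i st.sol)) := by
  rw [contribution, hst.1, subsample_coverage_insert]

lemma card_cov_union_contribution (S : Fin m → Finset U) (h : U → Bool) (st : State U m)
    (i : Fin m) :
    (st.cov ∪ contribution S h st i).card = st.cov.card + (contribution S h st i).card :=
  Finset.card_union_of_disjoint Finset.disjoint_sdiff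

lemma State.Consistent.processSet (hst : st.Consistent S k h) (i : Fin m) :
    (processSet S k ε lam r h st i).Consistent S k h := by
  have h1 : (checkBad S k ε lam h st i).Consistent S k h := by
    unfold checkBad
    split_ifs
    · exact hst
    · exact hst
  unfold MaxCover.processSet select
  split_ifs with h2
  · exact ⟨h1.insert_cov i, (Finset.card_insert_le _ _).trans h2.2.1⟩
  · exact h1

lemma finalState_consistent (S : Fin m → Finset U) (k : ℕ) (ε lam : ℝ) (h : U → Bool) :
    (finalState S k ε lam h).Consistent S k h := by
  refine foldl_invariant (R := fun _ st => State.Consistent S k h st) ?_ ?_ _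
  · simp [State.Consistent, State.init, coverage, subsample]
  · intro _ t st hst
    exact foldl_invariant (R := fun _ st => State.Consistent S k h st) hst
      (fun _ i st hst => hst.processSet i) _

/-- The state of a guess that has not been deactivated and whose sampled coverage falls short of
`O` by an amount that decreases geometrically in the number of selected sets, with remaining
contributions controlled by the threshold `r`. -/
structure GreedyInvariant (S : Fin m → Finset U) (k : ℕ) (ε : ℝ) (h : U → Bool) (O r : ℝ)
    (st : State U m) : Prop where
  consistent : st.Consistent S k h
  active : st.active = true
  deficit : O - st.cov.card ≤ (1 - 1 / ((1 + ε) * k)) ^ st.sol.card * O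
  remaining : st.sol.card < k → O - st.cov.card ≤ k * ((1 + ε) * r)

/-- The deficit before a selection is at most k(1+ε)r, so a gain of at least r removes a 1/((1+ε)k)
fraction of it. The bad-guess test cannot fire, since |C'| + |R_i| is the sampled coverage of at
most k sets. The monotonicity clauses keep contributions that were below r below r for the rest of
the pass. -/
lemma GreedyInvariant.processSet {O : ℝ} (hk : 1 ≤ k) (hε : 0 < ε) (hr : 0 < r)
    (hgood : ∀ J : Finset (Fin m), J.card ≤ k →
      ((subsample h (coverage S J)).card : ℝ) ≤ 2 * (1 + ε) * lam)
    (hst : GreedyInvariant S k ε h O r st) (i : Fin m) :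
    GreedyInvariant S k ε h O r (processSet S k ε lam r h st i) ∧
      st.cov ⊆ (processSet S k ε lam r h st i).cov ∧
      st.sol.card ≤ (processSet S k ε lam r h st i).sol.card ∧
      ((processSet S k ε lam r h st i).sol.card < k →
        ((contribution S h (processSet S k ε lam r h st i) i).card : ℝ) < r) := by
  have h1 : checkBad S k ε lam h st i = st := by
    unfold checkBad
    rw [if_neg]
    rintro ⟨h2, h3⟩
    have h4 := hgood (insert i st.sol) ((Finset.card_insert_le _ _).trans h2)
    rw [← hst.consistent.insert_cov i, card_cov_union_contribution] at h4
    push_cast at h4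
    linarith
  have hcons := hst.consistent.processSet (ε := ε) (lam := lam) (r := r) i
  unfold MaxCover.processSet at hcons ⊢
  rw [h1] at hcons ⊢
  unfold select at hcons ⊢
  split_ifs at hcons ⊢ with h2
  · obtain ⟨_, h3, h4⟩ := h2
    -- A set selected earlier contributes nothing, which is less than r > 0; hence the insertion
    -- really increases the cardinality.
    have hi : i ∉ st.sol := by
      intro hi
      have : contribution S h st i = ∅ := by
        rw [contribution, hst.consistent.1, Finset.sdiff_eq_empty_iff_subset]
        exact subsample_mono h (subset_coverage S hi)
      rw [this] at h4
      simp only [Finset.card_empty, Nat.cast_zero] at h4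
      linarith
    have hcard : (st.cov ∪ contribution S h st i).card =
      st.cov.card + (contribution S h st i).card := card_cov_union_contribution S h st i
    have hk0 : (0 : ℝ) < k := by exact_mod_cast hk
    have hrem := hst.remaining h3
    refine ⟨⟨hcons, hst.active, ?_, fun _ => ?_⟩, Finset.subset_union_left,
      Finset.card_le_card (Finset.subset_insert _ _), fun _ => ?_⟩
    · dsimp only
      rw [Finset.card_insert_of_notMem hi, hcard, pow_succ']
      push_cast
      have hq : 0 ≤ 1 - 1 / ((1 + ε) * k) := by
        rw [sub_nonneg, div_le_one (by positivity)]
        have : (1 : ℝ) ≤ k := by exact_mod_cast hk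
        nlinarith
      have h5 := mul_le_mul_of_nonneg_left hst.deficit hq
      have h6 : 1 / ((1 + ε) * k) * (O - st.cov.card) ≤ r := by
        rw [div_mul_eq_mul_div, div_le_iff₀ (by positivity)]
        linarith
      rw [mul_assoc]
      linarith
    · rw [hcard]
      push_cast
      have : (0 : ℝ) ≤ (contribution S h st i).card := Nat.cast_nonneg _
      linarith
    · have : contribution S h ⟨insert i st.sol, st.cov ∪ contribution S h st i, st.active⟩ i
          = ∅ := by
        rw [contribution, Finset.sdiff_eq_empty_iff_subset, contribution,
          Finset.union_sdiff_self_eq_union]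
        exact Finset.subset_union_right
      rw [this]
      simpa using hr
  · refine ⟨hst, subset_rfl, le_rfl, fun h3 => ?_⟩
    by_contra h4
    exact h2 ⟨hst.active, h3, not_lt.1 h4⟩

lemma card_sub_le_sum_contribution (S : Fin m → Finset U) (h : U → Bool) (st : State U m)
    (J : Finset (Fin m)) :
    ((subsample h (coverage S J)).card : ℝ) - st.cov.card ≤
      ∑ i ∈ J, ((contribution S h st i).card : ℝ) := by
  have h1 : subsample h (coverage S J) ⊆ st.cov ∪ J.biUnion (contribution S h st) := by
    intro x hx
    simp only [subsample, coverage, contribution, Finset.mem_filter, Finset.mem_biUnion,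
      Finset.mem_union, Finset.mem_sdiff] at hx ⊢
    grind
  have h2 := ((Finset.card_le_card h1).trans (Finset.card_union_le _ _)).trans
    (Nat.add_le_add_left Finset.card_biUnion_le _)
  have h3 : ((subsample h (coverage S J)).card : ℝ) ≤
      st.cov.card + ∑ i ∈ J, ((contribution S h st i).card : ℝ) := by exact_mod_cast h2
  linarith

/-- If fewer than k sets are selected at the end of the pass, every set contributes less than r, so
the at most k sets of J account for a deficit of at most kr. This is the invariant for the next
threshold r/(1+ε). -/
lemma GreedyInvariant.onePass (hk : 1 ≤ k) (hε : 0 < ε) (hr : 0 < r)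
    (hgood : ∀ J : Finset (Fin m), J.card ≤ k →
      ((subsample h (coverage S J)).card : ℝ) ≤ 2 * (1 + ε) * lam)
    {J : Finset (Fin m)} (hJ : J.card ≤ k)
    (hst : GreedyInvariant S k ε h (subsample h (coverage S J)).card r st) :
    GreedyInvariant S k ε h (subsample h (coverage S J)).card (r / (1 + ε))
      (onePass S k ε lam r h st) := by
  have key := foldl_invariant (f := MaxCover.processSet S k ε lam r h) (b := st)
    (R := fun l st => GreedyInvariant S k ε h (subsample h (coverage S J)).card r st ∧
      (st.sol.card < k → ∀ i ∈ l, ((contribution S h st i).card : ℝ) < r))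
    ⟨hst, by simp⟩ (by
      rintro l a st ⟨h1, h2⟩
      obtain ⟨h3, h4, h5, h6⟩ := h1.processSet hk hε hr hgood a
      refine ⟨h3, fun h7 i hi => ?_⟩
      rcases List.mem_append.1 hi with hi | hi
      · refine lt_of_le_of_lt ?_ (h2 (h5.trans_lt h7) i hi)
        exact_mod_cast Finset.card_le_card (Finset.sdiff_subset_sdiff subset_rfl h4)
      · rw [List.mem_singleton.1 hi]
        exact h6 h7) (List.finRange m)
  refine ⟨key.1.consistent, key.1.active, key.1.deficit, fun h1 => ?_⟩
  refine (card_sub_le_sum_contribution S h _ J).trans ?_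
  calc _ ≤ ∑ i ∈ J, r := Finset.sum_le_sum fun i _ => (key.2 h1 i (List.mem_finRange i)).le
    _ = J.card * r := by rw [Finset.sum_const, nsmul_eq_mul]
    _ ≤ k * r := by gcongr
    _ = _ := by field_simp

lemma finalState_greedyInvariant (hk : 1 ≤ k) (hε : 0 < ε) (hlam : 0 < lam)
    (hgood : ∀ J : Finset (Fin m), J.card ≤ k →
      ((subsample h (coverage S J)).card : ℝ) ≤ 2 * (1 + ε) * lam)
    {J : Finset (Fin m)} (hJ : J.card ≤ k) :
    GreedyInvariant S k ε h (subsample h (coverage S J)).card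
      (threshold k ε lam (numPasses ε)) (finalState S k ε lam h) := by
  have hk0 : (0 : ℝ) < k := by exact_mod_cast hk
  unfold finalState
  induction numPasses ε with
  | zero =>
    refine ⟨?_, rfl, ?_, fun _ => ?_⟩
    · simp [State.Consistent, State.init, coverage, subsample]
    · simp [State.init]
    · have h1 := hgood J hJ
      have h2 : (k : ℝ) * ((1 + ε) * threshold k ε lam 0) = (1 + ε) * (2 * (1 + ε) * lam) := by
        unfold threshold
        field_simp
      rw [List.range_zero, List.foldl_nil, h2]
      simp only [State.init, Finset.card_empty, Nat.cast_zero]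
      have : 0 < 2 * (1 + ε) * lam := by positivity
      nlinarith
  | succ t ih =>
    rw [List.range_succ, List.foldl_append]
    have h1 : threshold k ε lam (t + 1) = threshold k ε lam t / (1 + ε) := by
      unfold threshold
      rw [pow_succ, div_div _ _ (1 + ε)]
    rw [h1]
    exact ih.onePass hk hε (by unfold threshold; positivity) hgood hJ

lemma exp_neg_one_le_and_le :
    0.3678 ≤ 1 / Real.exp 1 ∧ 1 / Real.exp 1 ≤ 0.3679 := by
  have h1 := Real.exp_one_gt_d9
  have h2 := Real.exp_one_lt_d9
  constructor
  · rw [le_div_iff₀ (by positivity)]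
    linarith
  · rw [div_le_iff₀ (by positivity)]
    linarith

/-- The index `numPasses ε` is one past the last pass. One factor 1+ε cancels, and the other
⌈log_{1+ε}(4e)⌉ of them are worth at least 4e. -/
lemma mul_threshold_numPasses_le (hk : 1 ≤ k) (hε : 0 < ε) (hlam : 0 < lam) :
    k * ((1 + ε) * threshold k ε lam (numPasses ε)) ≤ (1 + ε) * lam * (1 / Real.exp 1) / 2 := by
  have hk0 : (0 : ℝ) < k := by exact_mod_cast hk
  have h1 : 4 * Real.exp 1 ≤ (1 + ε) ^ ⌈Real.logb (1 + ε) (4 * Real.exp 1)⌉₊ := by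
    rw [← Real.rpow_natCast, ← Real.logb_le_iff_le_rpow (by linarith) (by positivity)]
    exact Nat.le_ceil _
  unfold threshold numPasses
  set T := ⌈Real.logb (1 + ε) (4 * Real.exp 1)⌉₊
  have h2 : (k : ℝ) * ((1 + ε) * (2 * (1 + ε) * lam / k / (1 + ε) ^ (1 + T))) =
      2 * (1 + ε) * lam / (1 + ε) ^ T := by
    rw [pow_add, pow_one]
    field_simp
  rw [h2]
  calc _ ≤ 2 * (1 + ε) * lam / (4 * Real.exp 1) := by gcongr
    _ = _ := by field_simp; norm_num

/-- The power is at most e^{-1/(1+ε)} = e^{-1} e^{ε/(1+ε)}, and e^{ε/(1+ε)} ≤ 1+ε. -/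
lemma greedy_power_le (hk : 1 ≤ k) (hε : 0 < ε) :
    (1 - 1 / ((1 + ε) * k)) ^ k ≤ 1 / Real.exp 1 + ε := by
  have hk1 : (1 : ℝ) ≤ k := by exact_mod_cast hk
  have h1 : 1 - 1 / ((1 + ε) * k) ≤ Real.exp (-(1 / ((1 + ε) * k))) := by
    have := Real.add_one_le_exp (-(1 / ((1 + ε) * k)))
    linarith
  have h0 : 0 ≤ 1 - 1 / ((1 + ε) * k) := by
    rw [sub_nonneg, div_le_one (by positivity)]
    nlinarith
  have h2 : Real.exp (-(1 / ((1 + ε) * k))) ^ k = Real.exp (-(1 / (1 + ε))) := by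
    rw [← Real.exp_nat_mul]
    congr 1
    field_simp
  have h3 : Real.exp (-(1 / (1 + ε))) = Real.exp (-1) * Real.exp (ε / (1 + ε)) := by
    rw [← Real.exp_add]
    congr 1
    field_simp
    ring
  have h4 : Real.exp (ε / (1 + ε)) ≤ 1 + ε := by
    have h5 := Real.add_one_le_exp (-(ε / (1 + ε)))
    have h6 : -(ε / (1 + ε)) + 1 = (1 + ε)⁻¹ := by field_simp; ring
    rw [h6, Real.exp_neg] at h5
    exact (inv_le_inv₀ (by positivity) (Real.exp_pos _)).1 h5
  calc _ ≤ Real.exp (-(1 / ((1 + ε) * k))) ^ k := by gcongr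
    _ ≤ Real.exp (-1) * (1 + ε) := by rw [h2, h3]; gcongr
    _ = 1 / Real.exp 1 * (1 + ε) := by rw [Real.exp_neg, one_div]
    _ ≤ _ := by nlinarith [exp_neg_one_le_and_le.2]

/-- If no `k` sets have a large sampled coverage, then the thresholding procedure is a
`(1 - 1/e - ε)`-approximation on the sampled instance. -/
lemma finalState_approx (hk : 1 ≤ k) (hε : 0 < ε) (hε1 : ε < 1 - 1 / Real.exp 1) (hlam : 0 < lam)
    (hgood : ∀ J : Finset (Fin m), J.card ≤ k →
      ((subsample h (coverage S J)).card : ℝ) ≤ 2 * (1 + ε) * lam)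
    {J : Finset (Fin m)} (hJ : J.card ≤ k)
    (hlow : (1 - ε) * lam ≤ (subsample h (coverage S J)).card) :
    (finalState S k ε lam h).active = true ∧
      (1 - 1 / Real.exp 1 - ε) * (subsample h (coverage S J)).card ≤
        ((finalState S k ε lam h).cov.card : ℝ) := by
  have hinv := finalState_greedyInvariant hk hε hlam hgood hJ
  refine ⟨hinv.active, ?_⟩
  have he := exp_neg_one_le_and_le
  have hee : 1 / Real.exp 1 * Real.exp 1 = 1 := by field_simp
  set a := 1 / Real.exp 1
  have hO : (0 : ℝ) ≤ (subsample h (coverage S J)).card := Nat.cast_nonneg _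
  rcases hinv.consistent.2.lt_or_eq with h1 | h1
  · have h2 := (hinv.remaining h1).trans (mul_threshold_numPasses_le hk hε hlam)
    -- The difference of the two sides is concave in ε and positive at both ends, a/2 at ε = 0 and
    -- a²/2 at ε = 1-a. With `hlow` it turns the final threshold into a fraction of the sampled
    -- coverage of J.
    have h3 : (1 + ε) * a / 2 ≤ (a + ε) * (1 - ε) := by nlinarith
    have h4 : (a + ε) * ((1 - ε) * lam) ≤ (a + ε) * (subsample h (coverage S J)).card := by
      gcongr
    have h5 := mul_le_mul_of_nonneg_right h3 hlam.le
    linarith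
  · have h2 := hinv.deficit
    rw [h1] at h2
    have h3 := mul_le_mul_of_nonneg_right (greedy_power_le hk hε) hO
    linarith

end Greedy

/-! ### Counting index sets of size at most k -/

section Counting

lemma pow_succ_add_mul_pow_le (n j : ℕ) : n ^ (j + 1) + (j + 1) * n ^ j ≤ (n + 1) ^ (j + 1) := by
  induction j with
  | zero => simp
  | succ j ih =>
    calc n ^ (j + 1 + 1) + (j + 1 + 1) * n ^ (j + 1)
        ≤ (n ^ (j + 1) + (j + 1) * n ^ j) * (n + 1) := by ring_nf; omega
      _ ≤ (n + 1) ^ (j + 1) * (n + 1) := by gcongr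
      _ = _ := by ring

lemma two_pow_mul_factorial_le (k : ℕ) : 2 ^ k * k.factorial ≤ 2 * k ^ k := by
  induction k with
  | zero => simp
  | succ k ih =>
    have h1 : 2 ^ k * k.factorial ≤ (k + 1) ^ k := by
      cases k with
      | zero => simp
      | succ j =>
        have := pow_succ_add_mul_pow_le (j + 1) j
        rw [← pow_succ'] at this
        omega
    rw [Nat.factorial_succ]
    calc 2 ^ (k + 1) * ((k + 1) * k.factorial) = 2 * (k + 1) * (2 ^ k * k.factorial) := by ring
      _ ≤ 2 * (k + 1) * (k + 1) ^ k := by gcongr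
      _ = _ := by ring

/-- Induction on m by Pascal's rule, the two terms being absorbed by m^{j+1} + (j+1)m^j ≤
(m+1)^{j+1}. The diagonal k = m, where the sum is 2^k, is `two_pow_mul_factorial_le`. -/
lemma factorial_mul_sum_choose_le {m k : ℕ} (hkm : k ≤ m) :
    k.factorial * ∑ i ∈ Finset.range (k + 1), m.choose i ≤ 2 * m ^ k := by
  induction m generalizing k with
  | zero => simp [Nat.le_zero.1 hkm]
  | succ m ih =>
    rcases hkm.eq_or_lt with rfl | hlt
    · rw [Nat.sum_range_choose, mul_comm]
      exact two_pow_mul_factorial_le _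
    · cases k with
      | zero => simp
      | succ j =>
        have h1 := ih (Nat.lt_succ_iff.1 hlt)
        have h2 := ih (k := j) (by omega)
        have h3 : ∑ i ∈ Finset.range (j + 1 + 1), (m + 1).choose i =
            ∑ i ∈ Finset.range (j + 1 + 1), m.choose i + ∑ i ∈ Finset.range (j + 1), m.choose i := by
          rw [Finset.sum_range_succ', Finset.sum_range_succ' (fun i => m.choose i) (j + 1)]
          simp only [Nat.choose_succ_succ', Finset.sum_add_distrib, Nat.choose_zero_right]
          ring
        calc _ = (j + 1).factorial * ∑ i ∈ Finset.range (j + 1 + 1), m.choose i +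
              (j + 1) * (j.factorial * ∑ i ∈ Finset.range (j + 1), m.choose i) := by
                rw [h3, mul_add, ← mul_assoc (j + 1), ← Nat.factorial_succ]
          _ ≤ 2 * m ^ (j + 1) + (j + 1) * (2 * m ^ j) := by gcongr
          _ = 2 * (m ^ (j + 1) + (j + 1) * m ^ j) := by ring
          _ ≤ _ := by gcongr; exact pow_succ_add_mul_pow_le m j

lemma factorial_mul_card_le {m k : ℕ} (hkm : k ≤ m) :
    k.factorial * (Finset.univ.filter fun J : Finset (Fin m) => J.card ≤ k).card ≤ 2 * m ^ k := by
  refine le_trans ?_ (factorial_mul_sum_choose_le hkm)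
  gcongr
  have h1 : (Finset.univ.filter fun J : Finset (Fin m) => J.card ≤ k) ⊆
      (Finset.range (k + 1)).biUnion fun i => Finset.powersetCard i Finset.univ := by
    intro J hJ
    simpa [Nat.lt_succ_iff] using hJ
  refine ((Finset.card_le_card h1).trans Finset.card_biUnion_le).trans (le_of_eq ?_)
  simp

lemma two_mul_factorial_le {m k : ℕ} (hk : 1 ≤ k) (hkm : k ≤ m) (hm : 2 ≤ m) :
    2 * k.factorial ≤ m ^ k := by
  induction k, hk using Nat.le_induction with
  | base => simpa using hm
  | succ k hk ih =>
    rw [Nat.factorial_succ, pow_succ']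
    calc 2 * ((k + 1) * k.factorial) = (k + 1) * (2 * k.factorial) := by ring
      _ ≤ m * m ^ k := by gcongr; exact ih (by omega)

end Counting

/-! ### Cost of rounding the moment orders -/

section Numerics

/-- With l = ⌊L⌋ and x = L - l, the claim is (1+x/l)^l e^{1-x} ≥ 9/4. Bernoulli with exponent l/2 ≥
1 reduces it to l = 2, where the worst case is x → 1. -/
lemma floor_div_pow_mul_exp_le {L : ℝ} (hL : 2 ≤ L) :
    ((⌊L⌋₊ : ℝ) / L) ^ ⌊L⌋₊ * Real.exp (-⌊L⌋₊) ≤ 4 / 9 * Real.exp (1 - L) := by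
  have hl1 : (⌊L⌋₊ : ℝ) ≤ L := Nat.floor_le (by linarith)
  have hl2 : L < ⌊L⌋₊ + 1 := Nat.lt_floor_add_one L
  have hl3 : 2 ≤ ⌊L⌋₊ := Nat.le_floor (by exact_mod_cast hL)
  set l := ⌊L⌋₊
  have hl4 : (2 : ℝ) ≤ l := by exact_mod_cast hl3
  obtain ⟨x, hx⟩ : ∃ x, x = L - l := ⟨_, rfl⟩
  have hx0 : 0 ≤ x := by linarith
  have hx1 : x < 1 := by linarith
  have h1 : (1 + x / 2) ^ 2 ≤ (L / l) ^ l := by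
    have h0 : 0 ≤ x / l := by positivity
    have h2 : 1 + (l / 2 : ℝ) * (x / l) ≤ (1 + x / l) ^ (l / 2 : ℝ) :=
      one_add_mul_self_le_rpow_one_add (by linarith) (by linarith)
    have h3 : (l / 2 : ℝ) * (x / l) = x / 2 := by field_simp
    have h4 : 1 + x / l = L / l := by rw [hx]; field_simp; ring
    rw [h3, h4] at h2
    calc (1 + x / 2) ^ 2 ≤ ((L / l) ^ (l / 2 : ℝ)) ^ 2 := by gcongr
      _ = (L / l) ^ l := by
        rw [← Real.rpow_natCast, ← Real.rpow_mul (by positivity), ← Real.rpow_natCast]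
        congr 1
        push_cast
        ring
  have h5 : 1 + (1 - x) + (1 - x) ^ 2 / 2 ≤ Real.exp (1 - x) :=
    Real.quadratic_le_exp_of_nonneg (by linarith)
  have h6 : 9 / 4 ≤ (1 + x / 2) ^ 2 * Real.exp (1 - x) := by
    calc (9 / 4 : ℝ) ≤ (1 + x / 2) ^ 2 * (1 + (1 - x) + (1 - x) ^ 2 / 2) := by
          have hy : 0 ≤ 1 - x := by linarith
          nlinarith [mul_nonneg hx0 hy, mul_nonneg (mul_nonneg hx0 hx0) hy,
            mul_nonneg (mul_nonneg hx0 hy) hy, mul_nonneg (mul_nonneg (mul_nonneg hx0 hx0) hx0) hy]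
      _ ≤ _ := by gcongr
  have h7 : 9 / 4 ≤ (L / l) ^ l * Real.exp (1 - x) := h6.trans (by gcongr)
  have h8 : Real.exp (1 - L) = Real.exp (1 - x) * Real.exp (-l) := by
    rw [← Real.exp_add, hx]
    ring_nf
  have h9 : (l / L) ^ l * (L / l) ^ l = 1 := by
    rw [← mul_pow, div_mul_div_comm, mul_comm (l : ℝ) L, div_self (by positivity), one_pow]
  have h10 : (l / L) ^ l * (9 / 4) ≤ Real.exp (1 - x) := by
    calc (l / L) ^ l * (9 / 4) ≤ (l / L) ^ l * ((L / l) ^ l * Real.exp (1 - x)) := by gcongr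
      _ = _ := by rw [← mul_assoc, h9, one_mul]
  rw [h8]
  nlinarith [Real.exp_pos (-(l : ℝ))]

/-- From ⌊2L⌋ > 2L - 1 and log 2 > 1/2, the worst case is L = 2, with constant e/8 < 0.341. -/
lemma half_pow_floor_le {L : ℝ} (hL : 2 ≤ L) :
    (1 / 2 : ℝ) ^ ⌊2 * L⌋₊ ≤ 0.341 * Real.exp (1 - L) := by
  have h1 : 2 * L < ⌊2 * L⌋₊ + 1 := Nat.lt_floor_add_one _
  have hlog := Real.log_two_gt_d9
  have h2 : (1 / 2 : ℝ) ^ ⌊2 * L⌋₊ = Real.exp (-(⌊2 * L⌋₊ * Real.log 2)) := by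
    rw [Real.exp_neg, Real.exp_nat_mul, Real.exp_log (by norm_num)]
    simp
  have h3 : Real.exp (-(⌊2 * L⌋₊ * Real.log 2)) ≤
      Real.exp ((1 - L) + (1 - 3 * Real.log 2)) := by
    apply Real.exp_le_exp.2
    nlinarith
  have h4 : Real.exp (1 - 3 * Real.log 2) = Real.exp 1 / 8 := by
    rw [Real.exp_sub]
    congr 1
    rw [show (3 : ℝ) * Real.log 2 = (3 : ℕ) * Real.log 2 by norm_num, Real.exp_nat_mul,
      Real.exp_log (by norm_num)]
    norm_num
  rw [h2]
  refine h3.trans ?_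
  rw [Real.exp_add, h4]
  nlinarith [Real.exp_pos (1 - L), Real.exp_one_lt_d9]

lemma sum_half_pow_floor_le {L : ℝ} (hL : 2 ≤ L) (n : ℕ) :
    ∑ i ∈ Finset.range n, ((1 / 2 : ℝ) ^ (i + 1)) ^ ⌊2 * L⌋₊ ≤ 0.364 * Real.exp (1 - L) := by
  have h1 : 4 ≤ ⌊2 * L⌋₊ := Nat.le_floor (by push_cast; linarith)
  have h2 : (1 / 2 : ℝ) ^ ⌊2 * L⌋₊ ≤ 1 / 16 := by
    calc (1 / 2 : ℝ) ^ ⌊2 * L⌋₊ ≤ (1 / 2) ^ 4 :=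
          pow_le_pow_of_le_one (by norm_num) (by norm_num) h1
      _ = _ := by norm_num
  have h3 := half_pow_floor_le hL
  set x := (1 / 2 : ℝ) ^ ⌊2 * L⌋₊ with hx
  have hx0 : 0 < x := by positivity
  have h4 : ∀ i : ℕ, ((1 / 2 : ℝ) ^ (i + 1)) ^ ⌊2 * L⌋₊ = x * x ^ i := by
    intro i
    rw [hx, ← pow_succ', ← pow_mul, ← pow_mul, mul_comm]
  have h5 : ∑ i ∈ Finset.range n, x ^ i ≤ 16 / 15 := by
    rw [geom_sum_eq (by linarith), ← neg_div_neg_eq, div_le_div_iff₀ (by linarith) (by norm_num)]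
    have : 0 < x ^ n := by positivity
    linarith
  simp only [h4]
  rw [← Finset.mul_sum]
  nlinarith [Real.exp_pos (1 - L)]

end Numerics

/-! ### Tail bounds at the scale of the space budget -/

section Tails

variable {Ω : Type*} [MeasurableSpace Ω] {P : Measure Ω} [IsProbabilityMeasure P]
  {U : Type*} [Fintype U] {γ : ℕ} {p : ℝ} {h : Ω → U → Bool}

/-- The moment factor is ((2/3)e^{-1})^l ((l/L)e^{-1})^l: the second power yields e^{1-L}, while the
first, together with the exponential moment, is at most ρ^l ≤ ρ² because l ≥ 2. -/
lemma IsSampling.deviation_le (hs : IsSampling P γ p h) (hp0 : 0 ≤ p) (hp1 : p ≤ 1)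
    {lam ε L β ρ : ℝ} (hlam : 0 < lam) (hε : 0 < ε) (hε1 : ε < 0.6322)
    (hL : 2 ≤ L) (hεL : ε ^ 2 * lam = 6 * L) (hγ : ⌊2 * L⌋₊ ≤ γ)
    (hρ : 2 / 3 * Real.exp (0.56 * β - 1) ≤ ρ) (hρ1 : ρ ≤ 1)
    {A : Finset U} (hA : A.card * p ≤ β * lam) :
    P.real {ω | ε * lam ≤ |((subsample (h ω) A).card : ℝ) - A.card * p|} ≤
      8 / 9 * ρ ^ 2 * Real.exp (1 - L) := by
  have hfl := floor_div_pow_mul_exp_le hL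
  have hl1 : (⌊L⌋₊ : ℝ) ≤ L := Nat.floor_le (by linarith)
  have hl3 : 2 ≤ ⌊L⌋₊ := Nat.le_floor (by exact_mod_cast hL)
  have hlγ : 2 * ⌊L⌋₊ ≤ γ := by
    refine le_trans (Nat.le_floor ?_) hγ
    push_cast
    linarith
  set l := ⌊L⌋₊
  have hl4 : (2 : ℝ) ≤ l := by exact_mod_cast hl3
  have hl0 : (0 : ℝ) < l := by linarith
  -- The parameter s = √(l/λ) is nearly optimal for a mean of 2λ, the largest mean at the right
  -- guess. It is at most ε/√6 < 0.26.
  have hs2 : √(l / lam) ^ 2 = l / lam := Real.sq_sqrt (by positivity)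
  have hs0 : 0 < √(l / lam) := Real.sqrt_pos.2 (by positivity)
  have hs1 : √(l / lam) ≤ 0.26 := by
    rw [Real.sqrt_le_left (by norm_num), div_le_iff₀ hlam]
    have : ε ^ 2 ≤ 0.6322 ^ 2 := by gcongr
    nlinarith
  refine (hs.central_tail_le hp0 hp1 A (by omega) hlγ hs0 hs1 (by positivity)).trans ?_
  have h1 : (2 * l / (Real.exp 1 * √(l / lam) * (ε * lam))) ^ (2 * l) =
      (2 / 3 * Real.exp (-1)) ^ l * ((l / L) ^ l * Real.exp (-l)) := by
    have h2 : (2 * l / (Real.exp 1 * √(l / lam) * (ε * lam))) ^ 2 =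
        2 / 3 * Real.exp (-1) * (l / L * Real.exp (-1)) := by
      have h3 : (Real.exp 1 * √(l / lam) * (ε * lam)) ^ 2 = Real.exp 1 ^ 2 * (6 * L * l) := by
        rw [mul_pow, mul_pow, hs2, ← hεL]
        field_simp
      rw [div_pow, h3, Real.exp_neg]
      field_simp
      norm_num
    have h4 : Real.exp (-(l : ℝ)) = Real.exp (-1) ^ l := by
      rw [← Real.exp_nat_mul]
      ring_nf
    rw [pow_mul, h2, mul_pow, mul_pow (l / L), h4]
  have h5 : Real.exp (0.56 * (A.card * p) * √(l / lam) ^ 2) ≤ Real.exp (0.56 * β) ^ l := by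
    rw [← Real.exp_nat_mul]
    apply Real.exp_le_exp.2
    rw [hs2, mul_div_assoc', div_le_iff₀ hlam]
    nlinarith
  have h6 : (2 / 3 * Real.exp (0.56 * β - 1)) ^ l ≤ ρ ^ 2 := by
    calc (2 / 3 * Real.exp (0.56 * β - 1)) ^ l ≤ ρ ^ l := by gcongr
      _ ≤ ρ ^ 2 := pow_le_pow_of_le_one (le_trans (by positivity) hρ) hρ1 hl3
  rw [h1]
  calc _ ≤ (2 / 3 * Real.exp (-1)) ^ l * (4 / 9 * Real.exp (1 - L)) *
        (2 * Real.exp (0.56 * β) ^ l) := by gcongr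
    _ = 8 / 9 * (2 / 3 * Real.exp (0.56 * β - 1)) ^ l * Real.exp (1 - L) := by
      rw [sub_eq_add_neg (0.56 * β) 1, Real.exp_add, mul_pow, mul_pow, mul_pow]
      ring
    _ ≤ _ := by gcongr

/-- Since ελ = 6L/ε ≥ 2L, the margin ελ pays for the order q = ⌊2L⌋ subtracted in
`IsSampling.upper_tail_le`, and the ratio of the mean to the rest is at most 2^{-i}. -/
lemma IsSampling.far_tail_le (hs : IsSampling P γ p h) (hp0 : 0 ≤ p)
    {lam ε L b : ℝ} {i : ℕ} (hlam : 0 < lam) (hε : 0 < ε) (hε1 : ε < 0.6322)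
    (hL : 2 ≤ L) (hεL : ε ^ 2 * lam = 6 * L) (hγ : ⌊2 * L⌋₊ ≤ γ) (hb : 0 < b)
    {A : Finset U} (hA : A.card * p ≤ b * lam * (1 / 2) ^ i) :
    P.real {ω | (b + ε) * lam ≤ ((subsample (h ω) A).card : ℝ)} ≤
      ((1 / 2 : ℝ) ^ i) ^ ⌊2 * L⌋₊ := by
  have hq : (⌊2 * L⌋₊ : ℝ) ≤ ε * lam := by
    refine (Nat.floor_le (by linarith)).trans ?_
    have : 0 < ε * lam := by positivity
    nlinarith
  have hbl : 0 < b * lam := by positivity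
  refine (hs.upper_tail_le hp0 A hγ (by linarith)).trans ?_
  have h1 : 0 ≤ (A.card : ℝ) * p := by positivity
  have h2 : b * lam ≤ (b + ε) * lam - ⌊2 * L⌋₊ := by linarith
  have h3 : 0 < (b + ε) * lam - ⌊2 * L⌋₊ := by linarith
  gcongr
  rw [div_le_iff₀ h3]
  refine hA.trans ?_
  rw [mul_comm]
  gcongr

end Tails

/-! ### The guesses and OPT -/

section Guesses

variable {U : Type*} {m : ℕ}

lemma card_le_maxSetSize (S : Fin m → Finset U) (i : Fin m) : (S i).card ≤ maxSetSize S :=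
  Finset.le_sup (f := fun i => (S i).card) (Finset.mem_univ i)

lemma card_coverage_le_opt [DecidableEq U] (S : Fin m → Finset U) {k : ℕ} (hkm : k ≤ m)
    {J : Finset (Fin m)} (hJ : J.card ≤ k) : (coverage S J).card ≤ opt S k := by
  obtain ⟨J', hJJ', hJ'⟩ := Finset.exists_superset_card_eq hJ (by simpa using hkm)
  exact (Finset.card_le_card (coverage_mono S hJJ')).trans
    (Finset.le_sup (f := fun J => (coverage S J).card)
      (Finset.mem_powersetCard.2 ⟨Finset.subset_univ _, hJ'⟩))

lemma exists_card_coverage_eq_opt [DecidableEq U] (S : Fin m → Finset U) {k : ℕ} (hkm : k ≤ m) :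
    ∃ J : Finset (Fin m), J.card = k ∧ (coverage S J).card = opt S k := by
  obtain ⟨J, hJ, h⟩ := Finset.exists_mem_eq_sup (Finset.powersetCard k Finset.univ)
    (Finset.powersetCard_nonempty.2 (by simpa using hkm)) (fun J => (coverage S J).card)
  exact ⟨J, (Finset.mem_powersetCard.1 hJ).2, h.symm⟩

lemma maxSetSize_le_opt [DecidableEq U] (S : Fin m → Finset U) {k : ℕ} (hk : 1 ≤ k)
    (hkm : k ≤ m) : maxSetSize S ≤ opt S k := by
  refine Finset.sup_le fun i _ => ?_
  refine (Finset.card_le_card (subset_coverage S (Finset.mem_singleton_self i))).trans ?_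
  exact card_coverage_le_opt S hkm (by simpa using hk)

lemma opt_le_min [Fintype U] [DecidableEq U] (S : Fin m → Finset U) {k : ℕ} (hkm : k ≤ m) :
    (opt S k : ℝ) ≤ min (Fintype.card U : ℝ) (k * (maxSetSize S : ℝ)) := by
  obtain ⟨J, hJ, h⟩ := exists_card_coverage_eq_opt S hkm
  rw [← h]
  refine le_min (by exact_mod_cast Finset.card_le_univ _) ?_
  have := Finset.card_biUnion_le_card_mul J S (maxSetSize S) fun i _ => card_le_maxSetSize S i
  rw [hJ] at this
  exact_mod_cast this

lemma guess_add (S : Fin m → Finset U) (g i : ℕ) : guess S (g + i) = guess S g * 2 ^ i := by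
  unfold guess
  rw [pow_add]
  ring

lemma guess_strictMono {S : Fin m → Finset U} (hS : 0 < maxSetSize S) : StrictMono (guess S) := by
  refine strictMono_nat_of_lt_succ fun g => ?_
  have : (0 : ℝ) < maxSetSize S := by exact_mod_cast hS
  have : 0 < guess S g := by unfold guess; positivity
  rw [guess_add]
  linarith

lemma lt_two_mul_guess {S : Fin m → Finset U} (hS : 0 < maxSetSize S) (g : ℕ) :
    (g : ℝ) < 2 * guess S g := by
  have h1 : (1 : ℝ) ≤ maxSetSize S := by exact_mod_cast hS
  have h2 : (g : ℝ) < 2 ^ g := by exact_mod_cast Nat.lt_two_pow_self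
  unfold guess
  nlinarith

lemma lt_numGuesses [Fintype U] {S : Fin m → Finset U} (hS : 0 < maxSetSize S) {k g : ℕ}
    (hg : guess S g ≤ min (Fintype.card U : ℝ) (k * (maxSetSize S : ℝ))) :
    g < numGuesses S k := by
  -- Finiteness is essential: `Set.ncard` of an infinite set is 0. It holds because g < 2·`guess S
  -- g` ≤ 2n.
  have hfin : (guessSet S k).Finite := by
    refine ((Finset.range (2 * Fintype.card U + 1)).finite_toSet.image (guess S)).subset ?_
    rintro v ⟨g', rfl, h'⟩
    refine ⟨g', ?_, rfl⟩
    have h1 := (lt_two_mul_guess hS g').trans_le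
      (mul_le_mul_of_nonneg_left (h'.trans (min_le_left _ _)) zero_le_two)
    have h2 : g' < 2 * Fintype.card U := by exact_mod_cast h1
    simp only [Finset.coe_range, Set.mem_Iio]
    omega
  have hsub : guess S '' (Finset.range (g + 1)) ⊆ guessSet S k := by
    rintro _ ⟨g', hg', rfl⟩
    refine ⟨g', rfl, le_trans ((guess_strictMono hS).monotone ?_) hg⟩
    simpa [Nat.lt_succ_iff] using hg'
  have h1 := Set.ncard_le_ncard hsub hfin
  rw [Set.ncard_image_of_injective _ (guess_strictMono hS).injective, Set.ncard_coe_finset,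
    Finset.card_range] at h1
  exact h1

/-- The largest guess that does not exceed `OPT`. -/
lemma exists_right_guess [Fintype U] [DecidableEq U] {S : Fin m → Finset U}
    (hS : 0 < maxSetSize S) {k : ℕ} (hk : 1 ≤ k) (hkm : k ≤ m) :
    ∃ g < numGuesses S k, guess S g ≤ opt S k ∧ (opt S k : ℝ) < guess S (g + 1) := by
  classical
  have hex : ∃ g, (opt S k : ℝ) < guess S g := by
    refine ⟨2 * opt S k, ?_⟩
    have := lt_two_mul_guess hS (2 * opt S k)
    push_cast at this
    linarith
  -- The guess with index 0 is ‖S‖_∞/2, hence below OPT, so the first guess above OPT has a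
  -- predecessor.
  have h0 : Nat.find hex ≠ 0 := by
    intro h
    have h1 := Nat.find_spec hex
    have h2 : (maxSetSize S : ℝ) ≤ opt S k := by exact_mod_cast maxSetSize_le_opt S hk hkm
    rw [h] at h1
    unfold guess at h1
    have : (0 : ℝ) < maxSetSize S := by exact_mod_cast hS
    linarith
  obtain ⟨g, hg⟩ := Nat.exists_eq_succ_of_ne_zero h0
  have h1 : guess S g ≤ opt S k := not_lt.1 (Nat.find_min hex (by omega))
  refine ⟨g, lt_numGuesses hS (h1.trans (opt_le_min S hkm)), h1, ?_⟩
  have := Nat.find_spec hex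
  rwa [hg] at this

end Guesses

/-! ### Correctness when the sample behaves well -/

section Correctness

variable {U : Type*} [DecidableEq U] {m : ℕ}

lemma findGuess_spec {U : Type*} {m : ℕ} {ε lam : ℝ} {final : ℕ → State U m} {g N : ℕ}
    (hg : g < N)
    (hacc : Acceptable ε lam (final g)) :
    ∃ s, g ≤ s ∧ s < N ∧ Acceptable ε lam (final s) ∧ findGuess ε lam final N = some s := by
  induction N with
  | zero => omega
  | succ N ih =>
    unfold findGuess
    split_ifs with h
    · exact ⟨N, by omega, by omega, h, rfl⟩
    · have hgN : g ≠ N := fun h' => h (h' ▸ hacc)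
      obtain ⟨s, h1, h2, h3⟩ := ih (by omega)
      exact ⟨s, h1, by omega, h3⟩

/-- At a guess `v` with `OPT / 2 ≤ v ≤ OPT`, if all sampled coverages are concentrated, then the
solution is acceptable and good. -/
lemma finalState_right_guess {S : Fin m → Finset U} {k : ℕ} {ε lam v : ℝ} {h : U → Bool}
    (hk : 1 ≤ k) (hkm : k ≤ m) (hε : 0 < ε) (hε1 : ε < 1 - 1 / Real.exp 1) (hlam : 0 < lam)
    (hv0 : 0 < v) (hv1 : v ≤ opt S k) (hv2 : (opt S k : ℝ) ≤ 2 * v)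
    (hconc : ∀ J : Finset (Fin m), J.card ≤ k →
      |((subsample h (coverage S J)).card : ℝ) - (coverage S J).card * (lam / v)| < ε * lam) :
    Acceptable ε lam (finalState S k ε lam h) ∧
      (1 - 1 / Real.exp 1 - delta ε) * (opt S k : ℝ) ≤
        ((coverage S (finalState S k ε lam h).sol).card : ℝ) := by
  have hgood : ∀ J : Finset (Fin m), J.card ≤ k →
      ((subsample h (coverage S J)).card : ℝ) ≤ 2 * (1 + ε) * lam := by
    intro J hJ
    have h1 := (abs_lt.1 (hconc J hJ)).2
    have h2 : ((coverage S J).card : ℝ) ≤ 2 * v :=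
      le_trans (by exact_mod_cast card_coverage_le_opt S hkm hJ) hv2
    have h3 : ((coverage S J).card : ℝ) * (lam / v) ≤ 2 * lam := by
      rw [mul_div_assoc', div_le_iff₀ hv0]
      nlinarith
    have : 0 < ε * lam := by positivity
    linarith
  obtain ⟨J, hJ, hJopt⟩ := exists_card_coverage_eq_opt S hkm
  have hlow := (abs_lt.1 (hconc J hJ.le)).1
  rw [hJopt] at hlow
  have h1 : lam ≤ opt S k * (lam / v) := by
    rw [mul_div_assoc', le_div_iff₀ hv0]
    nlinarith
  obtain ⟨hact, happ⟩ := finalState_approx hk hε hε1 hlam hgood hJ.le (by linarith)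
  have hcons := finalState_consistent S k ε lam h
  have hI := (abs_lt.1 (hconc _ hcons.2)).2
  rw [← hcons.1] at hI
  unfold Acceptable delta
  set a := 1 / Real.exp 1
  have ha : 0 < 1 - a - ε := by linarith
  refine ⟨⟨hact, le_trans ?_ happ⟩, ?_⟩
  · rw [mul_comm (1 - ε), mul_assoc]
    gcongr
    linarith
  · set O := ((subsample h (coverage S J)).card : ℝ)
    set C := ((coverage S (finalState S k ε lam h).sol).card : ℝ)
    have h2 : (1 - a - ε) * (opt S k * (lam / v) - ε * lam) ≤ (1 - a - ε) * O := by
      gcongr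
      linarith
    have h3 : (1 - a - ε) * (opt S k * (lam / v) - ε * lam) - ε * lam ≤ C * (lam / v) := by
      linarith
    have h4 : ((1 - a - ε) * (opt S k - ε * v) - ε * v) * (lam / v) ≤ C * (lam / v) := by
      refine le_trans (le_of_eq ?_) h3
      field_simp
    have h5 := le_of_mul_le_mul_right h4 (by positivity)
    -- Replacing v by OPT leaves (1-a-ε)(1-ε) - ε = 1 - a - δ(ε): the ε(3-a-ε) lost is the greedy
    -- loss plus two sampling errors.
    have h6 : ((1 - a - ε) * ε + ε) * v ≤ ((1 - a - ε) * ε + ε) * opt S k := by gcongr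
    linarith

lemma machSketchFree_correct [Fintype U] {S : Fin m → Finset U} {k g : ℕ} {ε lam : ℝ}
    {h : ℕ → U → Bool} (hg : g < numGuesses S k)
    (hright : Acceptable ε lam (finalState S k ε lam (h g)) ∧
      (1 - 1 / Real.exp 1 - delta ε) * (opt S k : ℝ) ≤
        ((coverage S (finalState S k ε lam (h g)).sol).card : ℝ))
    (hwrong : ∀ s, g < s → s < numGuesses S k → ∀ J : Finset (Fin m), J.card ≤ k →
      (1 - ε) * (1 - 1 / Real.exp 1 - ε) * lam ≤ (subsample (h s) (coverage S J)).card →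
      (1 - 1 / Real.exp 1 - delta ε) * (opt S k : ℝ) ≤ ((coverage S J).card : ℝ)) :
    ∃ I : Finset (Fin m), machSketchFree S k ε lam h = some I ∧ I.card ≤ k ∧
      (1 - 1 / Real.exp 1 - delta ε) * (opt S k : ℝ) ≤ ((coverage S I).card : ℝ) := by
  obtain ⟨s, hgs, hsN, hacc, hfind⟩ := findGuess_spec
    (final := fun g => finalState S k ε lam (h g)) hg hright.1
  have hcons := finalState_consistent S k ε lam (h s)
  refine ⟨(finalState S k ε lam (h s)).sol, by rw [machSketchFree, hfind]; rfl, hcons.2, ?_⟩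
  rcases hgs.eq_or_lt with rfl | hlt
  · exact hright.2
  · refine hwrong s hlt hsN _ hcons.2 ?_
    rw [← hcons.1]
    exact hacc.2

end Correctness

/-! ### Failure probabilities for one index set -/

section Probability

variable {Ω : Type*} [MeasurableSpace Ω] {P : Measure Ω} [IsProbabilityMeasure P]
  {U : Type*} [Fintype U] {γ : ℕ} {h : Ω → U → Bool}

/-- The values of ρ for `IsSampling.deviation_le`, with β = 2 at the right guess and β = 0.6322 >
1-1/e at the next one. The factors (8/9)ρ² are then below 0.504 and 0.111. -/
lemma two_thirds_mul_exp_le :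
    2 / 3 * Real.exp (0.56 * 2 - 1) ≤ 0.7525 ∧
      2 / 3 * Real.exp (0.56 * 0.6322 - 1) ≤ 0.353 := by
  constructor
  · have h := exp_le_quadratic (s := 0.12) (by rw [abs_of_pos] <;> norm_num)
    norm_num at h ⊢
    linarith
  · have h := Real.sum_le_exp_of_nonneg (x := 1 - 0.56 * 0.6322) (by norm_num) 5
    have h2 : Real.exp (0.56 * 0.6322 - 1) = (Real.exp (1 - 0.56 * 0.6322))⁻¹ := by
      rw [← Real.exp_neg]
      norm_num
    rw [h2, ← div_eq_mul_inv, div_le_iff₀ (Real.exp_pos _)]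
    simp only [Finset.sum_range_succ, Finset.sum_range_zero] at h
    norm_num [Nat.factorial] at h ⊢
    linarith

variable {lam ε L : ℝ}

/-- The deviation at a guess `v` with `OPT ≤ 2 v`. -/
lemma right_guess_deviation_le {v : ℝ} (hv : 0 < v) (hlv : lam ≤ v)
    (hs : IsSampling P γ (lam / v) h)
    (hlam : 0 < lam) (hε : 0 < ε) (hε1 : ε < 0.6322)
    (hL : 2 ≤ L) (hεL : ε ^ 2 * lam = 6 * L) (hγ : ⌊2 * L⌋₊ ≤ γ)
    {A : Finset U} (hA : (A.card : ℝ) ≤ 2 * v) :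
    P.real {ω | ε * lam ≤ |((subsample (h ω) A).card : ℝ) - A.card * (lam / v)|} ≤
      0.504 * Real.exp (1 - L) := by
  refine (hs.deviation_le (by positivity) ((div_le_one hv).2 hlv) hlam hε hε1 hL hεL hγ
    (β := 2) two_thirds_mul_exp_le.1 (by norm_num) ?_).trans ?_
  · rw [mul_div_assoc', div_le_iff₀ hv]
    nlinarith
  · gcongr
    norm_num

/-- A set with small coverage is unlikely to look good at the first guess above `OPT`. -/
lemma next_guess_tail_le {v b O : ℝ} (hO : 0 ≤ O) (hOv : O < v)
    (hs : IsSampling P γ (min 1 (lam / v)) h)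
    (hlam : 0 < lam) (hε : 0 < ε) (hε1 : ε < 0.6322) (hb : b ≤ 0.6322)
    (hL : 2 ≤ L) (hεL : ε ^ 2 * lam = 6 * L) (hγ : ⌊2 * L⌋₊ ≤ γ) (A : Finset U) :
    P.real {ω | (A.card : ℝ) < b * O ∧ (b + ε) * lam ≤ (subsample (h ω) A).card} ≤
      0.111 * Real.exp (1 - L) := by
  have hv : 0 < v := hO.trans_lt hOv
  by_cases hA : (A.card : ℝ) < b * O
  · have hb0 : 0 < b := by
      by_contra hb0
      have : (0 : ℝ) ≤ A.card := Nat.cast_nonneg _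
      nlinarith
    have hp0 : 0 ≤ min 1 (lam / v) := le_min zero_le_one (by positivity)
    have hμ : A.card * min 1 (lam / v) ≤ b * lam := by
      calc A.card * min 1 (lam / v) ≤ (b * v) * (lam / v) := by
            gcongr
            · exact hA.le.trans (by gcongr)
            · exact min_le_right _ _
        _ = b * lam := by field_simp
    have h1 := hs.deviation_le hp0 (min_le_left _ _) hlam hε hε1 hL hεL hγ
      (β := 0.6322) two_thirds_mul_exp_le.2 (by norm_num) (A := A) (hμ.trans (by gcongr))
    refine le_trans (measureReal_mono fun ω hω => ?_) (h1.trans ?_)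
    · have h2 := hω.2
      have h3 : ε * lam ≤ (subsample (h ω) A).card - A.card * min 1 (lam / v) := by linarith
      exact h3.trans (le_abs_self _)
    · gcongr
      norm_num
  · simp only [hA, false_and, Set.ofPred_false, measureReal_empty]
    positivity

/-- A set with small coverage is unlikely to look good at a guess that is much larger than `OPT`. -/
lemma far_guess_tail_le {v b O : ℝ} {i : ℕ} (hO : 0 ≤ O) (hOv : O < v)
    (hs : IsSampling P γ (min 1 (lam / (v * 2 ^ i))) h)
    (hlam : 0 < lam) (hε : 0 < ε) (hε1 : ε < 0.6322)
    (hL : 2 ≤ L) (hεL : ε ^ 2 * lam = 6 * L) (hγ : ⌊2 * L⌋₊ ≤ γ) (A : Finset U) :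
    P.real {ω | (A.card : ℝ) < b * O ∧ (b + ε) * lam ≤ (subsample (h ω) A).card} ≤
      ((1 / 2 : ℝ) ^ i) ^ ⌊2 * L⌋₊ := by
  have hv : 0 < v := hO.trans_lt hOv
  by_cases hA : (A.card : ℝ) < b * O
  · have hb0 : 0 < b := by
      by_contra hb0
      have : (0 : ℝ) ≤ A.card := Nat.cast_nonneg _
      nlinarith
    have hp0 : 0 ≤ min 1 (lam / (v * 2 ^ i)) := le_min zero_le_one (by positivity)
    have hμ : A.card * min 1 (lam / (v * 2 ^ i)) ≤ b * lam * (1 / 2) ^ i := by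
      calc A.card * min 1 (lam / (v * 2 ^ i)) ≤ (b * v) * (lam / (v * 2 ^ i)) := by
            gcongr
            · exact hA.le.trans (by gcongr)
            · exact min_le_right _ _
        _ = b * lam * (1 / 2) ^ i := by rw [one_div, inv_pow]; field_simp
    refine le_trans (measureReal_mono fun ω hω => hω.2)
      (hs.far_tail_le hp0 hlam hε hε1 hL hεL hγ hb0 hμ)
  · simp only [hA, false_and, Set.ofPred_false, measureReal_empty]
    positivity

end Probability

end MaxCover

/-! ### The union bound -/

theorem mainTheorem3 {U : Type*} [Fintype U] [DecidableEq U]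
    {Ω : Type*} [MeasurableSpace Ω] (P : Measure Ω) [IsProbabilityMeasure P]
    {m k γ : ℕ} (S : Fin m → Finset U) (hk : 1 ≤ k) (hkm : k ≤ m)
    (c ε : ℝ) (hc : 0 < c) (hε0 : 0 < ε) (hε1 : ε < 1 - 1 / Real.exp 1)
    (hγ : ⌊c / 3 * k * Real.log m⌋₊ ≤ γ)
    (hright : ∀ g < MaxCover.numGuesses S k,
      (MaxCover.opt S k : ℝ) / 2 ≤ MaxCover.guess S g →
      MaxCover.guess S g ≤ (MaxCover.opt S k : ℝ) →
      MaxCover.spaceBudget c ε k m ≤ MaxCover.guess S g)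
    (h : ℕ → Ω → U → Bool)
    (hh : ∀ g < MaxCover.numGuesses S k,
      MaxCover.IsSampling P γ (min 1 (MaxCover.spaceBudget c ε k m / MaxCover.guess S g)) (h g)) :
    1 - 2 * Real.exp 1 / ((k.factorial : ℝ) * (m : ℝ) ^ ((c / 6 - 1) * (k : ℝ))) ≤
      P.real {ω | ∃ I : Finset (Fin m),
        MaxCover.machSketchFree S k ε (MaxCover.spaceBudget c ε k m) (fun g => h g ω) = some I ∧
        I.card ≤ k ∧
        (1 - 1 / Real.exp 1 - MaxCover.delta ε) * (MaxCover.opt S k : ℝ) ≤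
          ((MaxCover.coverage S I).card : ℝ)} := by
  classical
  have hm0 : (0 : ℝ) < m := by exact_mod_cast (hk.trans hkm)
  have hk0 : (0 : ℝ) < k := by exact_mod_cast hk
  have hfac : (0 : ℝ) < k.factorial := by exact_mod_cast k.factorial_pos
  obtain ⟨L, hLdef⟩ : ∃ L, L = c / 6 * k * Real.log m := ⟨_, rfl⟩
  have hbound : 2 * Real.exp 1 / ((k.factorial : ℝ) * (m : ℝ) ^ ((c / 6 - 1) * (k : ℝ))) =
      2 * (m : ℝ) ^ k / k.factorial * Real.exp (1 - L) := by
    have h1 : (m : ℝ) ^ ((c / 6 - 1) * (k : ℝ)) = Real.exp L / (m : ℝ) ^ k := by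
      rw [sub_mul, Real.rpow_sub hm0, one_mul, Real.rpow_natCast, Real.rpow_def_of_pos hm0, hLdef]
      ring_nf
    rw [h1, Real.exp_sub]
    field_simp
  rw [hbound]
  rcases le_or_gt (1 - 2 * (m : ℝ) ^ k / k.factorial * Real.exp (1 - L)) 0 with htriv | hpos
  · exact htriv.trans measureReal_nonneg
  -- the bound is nontrivial, so that `m ≥ 2` and `L ≥ 2`
  have hm2 : 2 ≤ m := by
    by_contra hm2
    have hm1 : m = 1 := by omega
    have hk1 : k = 1 := by omega
    subst hm1 hk1
    norm_num at hLdef hpos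
    rw [hLdef] at hpos
    have := Real.exp_one_gt_d9
    norm_num at hpos
    linarith
  have hL : 2 ≤ L := by
    by_contra hL
    have h1 : (2 : ℝ) ≤ (m : ℝ) ^ k / k.factorial := by
      rw [le_div_iff₀ hfac]
      exact_mod_cast MaxCover.two_mul_factorial_le hk hkm hm2
    have h2 : Real.exp (-1) ≤ Real.exp (1 - L) := Real.exp_le_exp.2 (by linarith)
    have h3 : 0.3678 ≤ Real.exp (-1) := by
      rw [Real.exp_neg, ← one_div]
      exact MaxCover.exp_neg_one_le_and_le.1
    have h4 : 2 * 2 * 0.3678 ≤ 2 * ((m : ℝ) ^ k / k.factorial) * Real.exp (1 - L) := by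
      gcongr
      linarith
    rw [← mul_div_assoc] at h4
    linarith
  have hlogm : 0 < Real.log m := Real.log_pos (by exact_mod_cast hm2)
  have hεL : ε ^ 2 * MaxCover.spaceBudget c ε k m = 6 * L := by
    unfold MaxCover.spaceBudget
    rw [hLdef]
    field_simp
  have hlam : 0 < MaxCover.spaceBudget c ε k m := by
    unfold MaxCover.spaceBudget
    positivity
  have hγ' : ⌊2 * L⌋₊ ≤ γ := by
    convert hγ using 2
    rw [hLdef]
    ring
  set lam := MaxCover.spaceBudget c ε k m
  have hε2 : ε < 0.6322 := by linarith [MaxCover.exp_neg_one_le_and_le.1]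
  -- If all sets were empty, 0 would be the only guess and would lie between OPT/2 and OPT, so
  -- `hright` would give λ ≤ 0.
  have hS : 0 < MaxCover.maxSetSize S := by
    by_contra hS
    have hS0 : MaxCover.maxSetSize S = 0 := by omega
    have hopt : (MaxCover.opt S k : ℝ) = 0 := by
      have h1 := (MaxCover.opt_le_min S hkm).trans (min_le_right _ _)
      rw [hS0, Nat.cast_zero, mul_zero] at h1
      exact le_antisymm h1 (Nat.cast_nonneg _)
    have hguess : ∀ g, MaxCover.guess S g = 0 := by
      intro g
      simp [MaxCover.guess, hS0]
    have hnum : 0 < MaxCover.numGuesses S k := by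
      have : MaxCover.guessSet S k = {0} := by
        ext v
        simp [MaxCover.guessSet, hguess, hS0]
        rintro rfl
        exact le_rfl
      rw [MaxCover.numGuesses, this, Set.ncard_singleton]
      exact zero_lt_one
    have := hright 0 hnum (by simp [hguess, hopt]) (by simp [hguess, hopt])
    rw [hguess] at this
    linarith
  obtain ⟨g, hgN, hg1, hg2⟩ := MaxCover.exists_right_guess hS hk hkm
  have hv : 0 < MaxCover.guess S g := by
    have : (0 : ℝ) < MaxCover.maxSetSize S := by exact_mod_cast hS
    unfold MaxCover.guess
    positivity
  have hg3 : (MaxCover.opt S k : ℝ) < 2 * MaxCover.guess S g := by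
    rw [MaxCover.guess_add] at hg2
    linarith
  have hlv := hright g hgN (by linarith) hg1
  have hsg := hh g hgN
  rw [min_eq_right ((div_le_one hv).2 hlv)] at hsg
  obtain ⟨b, hb⟩ : ∃ b, b = 1 - 1 / Real.exp 1 - MaxCover.delta ε := ⟨_, rfl⟩
  -- The acceptance level exceeds the mean bound bλ by exactly ελ, the deviation the tail bounds
  -- control.
  have hbε : (1 - ε) * (1 - 1 / Real.exp 1 - ε) = b + ε := by
    rw [hb, MaxCover.delta]
    ring
  have hb1 : b ≤ 0.6322 := by
    have h1 : 0 ≤ MaxCover.delta ε := by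
      unfold MaxCover.delta
      have := MaxCover.exp_neg_one_le_and_le.2
      exact mul_nonneg hε0.le (by linarith)
    linarith [MaxCover.exp_neg_one_le_and_le.1]
  set O : ℝ := (MaxCover.opt S k : ℝ)
  set F := Finset.univ.filter fun J : Finset (Fin m) => J.card ≤ k with hF
  set N := MaxCover.numGuesses S k
  let bad : Finset (Fin m) → Set Ω := fun J =>
    {ω | ε * lam ≤ |((MaxCover.subsample (h g ω) (MaxCover.coverage S J)).card : ℝ) -
      (MaxCover.coverage S J).card * (lam / MaxCover.guess S g)|}
  -- The clause `s < N` makes the event empty beyond the last guess, where nothing is known about `h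
  -- s`; the union over `Finset.range N` may thus overshoot.
  let wrong : ℕ → Finset (Fin m) → Set Ω := fun s J =>
    {ω | s < N ∧ ((MaxCover.coverage S J).card : ℝ) < b * O ∧
      (b + ε) * lam ≤ (MaxCover.subsample (h s ω) (MaxCover.coverage S J)).card}
  have hO : 0 ≤ O := Nat.cast_nonneg _
  have hbad : ∀ J ∈ F, P.real (bad J) ≤ 0.504 * Real.exp (1 - L) := by
    intro J hJ
    refine MaxCover.right_guess_deviation_le hv hlv hsg hlam hε0 hε2 hL hεL hγ' ?_
    exact (Nat.cast_le.2
      (MaxCover.card_coverage_le_opt S hkm (Finset.mem_filter.1 hJ).2)).trans hg3.le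
  have hnext : ∀ J, P.real (wrong (g + 1) J) ≤ 0.111 * Real.exp (1 - L) := by
    intro J
    by_cases hN : g + 1 < N
    · refine le_trans (measureReal_mono fun ω hω => hω.2) (MaxCover.next_guess_tail_le hO hg2
        (hh _ hN) hlam hε0 hε2 hb1 hL hεL hγ' (MaxCover.coverage S J))
    · simp only [wrong, hN, false_and, Set.ofPred_false, measureReal_empty]
      positivity
  have hfar : ∀ J i, P.real (wrong (g + 1 + (i + 1)) J) ≤
      ((1 / 2 : ℝ) ^ (i + 1)) ^ ⌊2 * L⌋₊ := by
    intro J i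
    by_cases hN : g + 1 + (i + 1) < N
    · have hs := hh _ hN
      rw [MaxCover.guess_add S (g + 1)] at hs
      exact le_trans (measureReal_mono fun ω hω => hω.2) (MaxCover.far_guess_tail_le hO hg2
        hs hlam hε0 hε2 hL hεL hγ' (MaxCover.coverage S J))
    · simp only [wrong, hN, false_and, Set.ofPred_false, measureReal_empty]
      positivity
  let fail : Finset (Fin m) → Set Ω := fun J =>
    bad J ∪ wrong (g + 1) J ∪ ⋃ i ∈ Finset.range N, wrong (g + 1 + (i + 1)) J
  have hfail : ∀ J ∈ F, P.real (fail J) ≤ Real.exp (1 - L) := by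
    intro J hJ
    have h1 : P.real (⋃ i ∈ Finset.range N, wrong (g + 1 + (i + 1)) J) ≤
        0.364 * Real.exp (1 - L) :=
      (measureReal_biUnion_finset_le _ _).trans ((Finset.sum_le_sum fun i _ => hfar J i).trans
        (MaxCover.sum_half_pow_floor_le hL N))
    have h2 := measureReal_union_le (μ := P) (bad J ∪ wrong (g + 1) J)
      (⋃ i ∈ Finset.range N, wrong (g + 1 + (i + 1)) J)
    have h3 := measureReal_union_le (μ := P) (bad J) (wrong (g + 1) J)
    have h4 := hbad J hJ
    have h5 := hnext J
    have h6 := Real.exp_pos (1 - L)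
    simp only [fail]
    linarith
  have hfailF : P.real (⋃ J ∈ F, fail J) ≤
      2 * (m : ℝ) ^ k / k.factorial * Real.exp (1 - L) := by
    have h1 : (F.card : ℝ) ≤ 2 * (m : ℝ) ^ k / k.factorial := by
      rw [le_div_iff₀ hfac, mul_comm]
      exact_mod_cast MaxCover.factorial_mul_card_le hkm
    calc _ ≤ ∑ J ∈ F, P.real (fail J) := measureReal_biUnion_finset_le _ _
      _ ≤ ∑ J ∈ F, Real.exp (1 - L) := Finset.sum_le_sum hfail
      _ = F.card * Real.exp (1 - L) := by rw [Finset.sum_const, nsmul_eq_mul]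
      _ ≤ _ := by gcongr
  -- Covering the whole space by success and failure needs only subadditivity, so the success event
  -- need not be shown measurable.
  have hcover : (Set.univ : Set Ω) ⊆ {ω | ∃ I : Finset (Fin m),
      MaxCover.machSketchFree S k ε lam (fun g => h g ω) = some I ∧ I.card ≤ k ∧
      (1 - 1 / Real.exp 1 - MaxCover.delta ε) * O ≤ ((MaxCover.coverage S I).card : ℝ)} ∪
      ⋃ J ∈ F, fail J := by
    intro ω _
    by_cases hω : ω ∈ ⋃ J ∈ F, fail J
    · exact Or.inr hω
    · left
      have hgood : ∀ J : Finset (Fin m), J.card ≤ k → ω ∉ fail J := by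
        intro J hJ hJω
        exact hω (Set.mem_biUnion (Finset.mem_filter.2 ⟨Finset.mem_univ J, hJ⟩) hJω)
      refine MaxCover.machSketchFree_correct (h := fun g => h g ω) hgN
        (MaxCover.finalState_right_guess hk hkm hε0 hε1 hlam hv hg1 hg3.le fun J hJ => ?_) ?_
      · by_contra hcon
        exact hgood J hJ (Or.inl (Or.inl (not_lt.1 hcon)))
      · intro s hgs hsN J hJ hsamp
        rw [← hb]
        rw [hbε] at hsamp
        by_contra hcon
        have hw : ω ∈ wrong s J := ⟨hsN, not_le.1 hcon, hsamp⟩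
        apply hgood J hJ
        rcases (Nat.succ_le_of_lt hgs).eq_or_lt with hs | hs
        · exact Or.inl (Or.inr (by rwa [← hs] at hw))
        · obtain ⟨i, hi⟩ := Nat.exists_eq_add_of_le (show g + 1 + 1 ≤ s from hs)
          have hs' : s = g + 1 + (i + 1) := by omega
          refine Or.inr (Set.mem_biUnion (x := i) (Finset.mem_coe.2 (Finset.mem_range.2 ?_)) ?_)
          · omega
          · rwa [← hs']
  have htotal := (measureReal_mono (μ := P) hcover).trans (measureReal_union_le _ _)
  rw [probReal_univ] at htotal
  linarith
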